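/- Let $k$ be an algebraically closed field of arbitrary characteristic and let $X$ be a reduced scheme of finite type over $k$. For $m\ge 0$ let $X_m$ denote the $m$-jet scheme of $X$, that is, the $k$-scheme representing the contravariant functor $$Y\longmapsto \operatorname{Hom}_k\bigl(Y\times_{\operatorname{Spec}k}\operatorname{Spec}k[t]/(t^{m+1}),\,X\bigr)$$ on $k$-schemes; such a scheme exists for every $m\ge 0$ and is unique up to unique isomorphism. For $m<m'$ let $\psi_{m',m}\colon X_{m'}\to X_m$ be the truncation morphism induced by the canonical surjection $k[t]/(t^{m'+1})\to k[t]/(t^{m+1})$. Then $X$ is non-singular (that is, all its local rings are regular local rings) if and only if there is a pair of integers $0<m<m'$ such that the truncation morphism $\psi_{m',m}\colon X_{m'}\to X_m$ is flat. -/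

import Mathlib

open CategoryTheory AlgebraicGeometry Opposite MonoidalCategory

universe u

noncomputable section

/-- The truncated polynomial ring `k[t]/(t^(m+1))`. -/
abbrev JetRing (k : Type u) [Field k] (m : ℕ) : Type u :=
  Polynomial k ⧸ Ideal.span {(Polynomial.X : Polynomial k) ^ (m + 1)}

/-- For `m ≤ m'`, the canonical surjection `k[t]/(t^(m'+1)) → k[t]/(t^(m+1))`. -/
def JetRing.reduction (k : Type u) [Field k] {m m' : ℕ} (h : m ≤ m') :
    JetRing k m' →ₐ[k] JetRing k m :=
  Ideal.Quotient.factorₐ k (by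
    rw [Ideal.span_singleton_le_span_singleton]
    exact pow_dvd_pow _ (Nat.succ_le_succ h))

/-- `Spec k[t]/(t^(m+1))` as a scheme over `k`. -/
def jetDisc (k : Type u) [Field k] (m : ℕ) : Over (Spec (CommRingCat.of k)) :=
  Over.mk (Spec.map (CommRingCat.ofHom (algebraMap k (JetRing k m))))

/-- For `m ≤ m'`, the closed immersion `Spec k[t]/(t^(m+1)) → Spec k[t]/(t^(m'+1))` over `k`. -/
def jetDisc.incl (k : Type u) [Field k] {m m' : ℕ} (h : m ≤ m') :
    jetDisc k m ⟶ jetDisc k m' :=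
  Over.homMk (Spec.map (CommRingCat.ofHom (JetRing.reduction k h).toRingHom)) (by
    change Spec.map _ ≫ Spec.map _ = Spec.map _
    rw [← Spec.map_comp, ← CommRingCat.ofHom_comp]
    congr 2)

variable {k : Type u} [Field k]

/-- The contravariant functor `Y ↦ Hom_k(Y ×_k Spec k[t]/(t^(m+1)), X)` on schemes over `k`.
(The tensor product on `Over (Spec k)` is the fibre product over `Spec k`.) -/
def jetFunctor (X : Over (Spec (CommRingCat.of k))) (m : ℕ) :
    (Over (Spec (CommRingCat.of k)))ᵒᵖ ⥤ Type u :=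
  (tensorRight (jetDisc k m)).op ⋙ yoneda.obj X

/-- Restriction of families of `m'`-jets to families of `m`-jets: precomposition with
`Y ×_k Spec k[t]/(t^(m+1)) → Y ×_k Spec k[t]/(t^(m'+1))`. -/
def jetFunctor.restrict (X : Over (Spec (CommRingCat.of k))) {m m' : ℕ} (h : m ≤ m')
    (Y : Over (Spec (CommRingCat.of k))) (γ : Y ⊗ jetDisc k m' ⟶ X) : Y ⊗ jetDisc k m ⟶ X :=
  (Y ◁ jetDisc.incl k h) ≫ γ

/-- An `m`-jet scheme of `X`: a scheme over `k` together with a natural bijection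
`Hom_k(Y, X_m) ≃ Hom_k(Y ×_k Spec k[t]/(t^(m+1)), X)`. By the Yoneda lemma it is unique up to
unique isomorphism. -/
structure JetScheme (X : Over (Spec (CommRingCat.of k))) (m : ℕ) where
  /-- the underlying `k`-scheme `X_m` -/
  scheme : Over (Spec (CommRingCat.of k))
  /-- the universal property -/
  representableBy : (jetFunctor X m).RepresentableBy scheme

/-- The universal family of `m`-jets `X_m ×_k Spec k[t]/(t^(m+1)) → X`. -/
def JetScheme.universal {X : Over (Spec (CommRingCat.of k))} {m : ℕ} (J : JetScheme X m) :
    J.scheme ⊗ jetDisc k m ⟶ X :=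
  J.representableBy.homEquiv (𝟙 J.scheme)

/-- The truncation morphism `ψ_{m',m} : X_{m'} → X_m`: the morphism that classifies the
restriction to `m`-jets of the universal family of `m'`-jets. -/
def JetScheme.truncation {X : Over (Spec (CommRingCat.of k))} {m m' : ℕ} (h : m ≤ m')
    (J' : JetScheme X m') (J : JetScheme X m) : J'.scheme ⟶ J.scheme :=
  J.representableBy.homEquiv.symm (jetFunctor.restrict X h J'.scheme J'.universal)

/-- A scheme is non-singular if all its local rings are regular local rings. -/
def IsNonsingular (X : Scheme.{u}) : Prop :=
  ∀ x : X, IsRegularLocalRing (X.presheaf.stalk x)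

end

/-! Flatness of a truncation morphism is equivalent to non-singularity for every pair `m < m'`
(`JetScheme.flat_truncation_iff`). Both properties are local on `X`, because the disc `Spec
k[t]/(t^(m+1))` has a single point: a jet lies in an open `U` as soon as its base point does, so
`U_m` is the preimage of `U` in `X_m`. The same fact lets jet schemes of affine charts glue. This
leaves `X = Spec A`, where `X_m = Spec R` and `X_{m'} = Spec R'` are Weil restrictions given by
equations in coordinates.

If `A` is regular, it is smooth over the perfect field `k`. Infinitesimal lifting for `A` then makes
`R → R'` formally smooth (`AlgHom.IsUniversalFamily.formallySmooth`), hence smooth and flat.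

Conversely, let `R → R'` be flat, and base change it along the map `R → A` that classifies constant
jets. The result `G = A ⊗[R] R'` is flat over `A` and parametrises `m'`-jets with constant
`m`-truncation. Since `2(m+1) > m+1`, the coefficient of `t^(m+1)` in the universal such jet is a
derivation `A → G`, that is, a linear map `Ω[A⁄k] → G`. The jet `a + t^(m+1) da` over the
square-zero extension `A ⊕ Ω[A⁄k]` gives a map back, so `Ω[A⁄k]` is a direct summand of `G` and is
flat (`AlgHom.IsUniversalFamily.flat_kaehlerDifferential`). Nothing is divided by integers, so the
characteristic plays no role. For reduced `A` this forces regularity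
(`IsRegularLocalRing.of_flat_kaehlerDifferential`).

Regularity, smoothness and differentials are linked by one device: suitable functions make `A`
unramified over a polynomial ring at a given point, so the local ring there is a quotient of a local
ring of an étale algebra, which is a regular domain. The quotient map is injective, by dimension if
`A` is regular, and by the conormal sequence if the differentials are locally free. -/

section

/-! ### Regular local rings are domains -/

section RegularLocal

open IsLocalRing

/-- Dividing a Noetherian local ring by an element of `𝔪 ∖ 𝔪²` lowers the embedding dimension. -/
lemma IsLocalRing.spanFinrank_maximalIdeal_quotient_span_singleton_lt {R : Type*} [CommRing R]
    [IsLocalRing R] [IsNoetherianRing R] {x : R} (hx : x ∈ maximalIdeal R)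
    (hx2 : x ∉ maximalIdeal R ^ 2) [IsLocalRing (R ⧸ Ideal.span {x})] :
    (maximalIdeal (R ⧸ Ideal.span {x})).spanFinrank + 1 ≤ (maximalIdeal R).spanFinrank := by
  classical
  let V := CotangentSpace R
  let c : maximalIdeal R → V := (maximalIdeal R).toCotangent
  have hc : Function.Surjective c := Ideal.toCotangent_surjective _
  let v : V := c ⟨x, hx⟩
  have hv : v ≠ 0 := by
    intro h
    exact hx2 ((Ideal.toCotangent_eq_zero _ _).mp h)
  have hli : LinearIndepOn (ResidueField R) id ({v} : Set V) := LinearIndepOn.singleton hv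
  -- The class of `x` is completed to a basis of the cotangent space and lifted to generators of the
  -- maximal ideal by Nakayama. In the quotient `x` dies, which leaves one generator fewer.
  let T : Set V := hli.extend (Set.subset_univ _)
  let b : Module.Basis T (ResidueField R) V := .extend hli
  have hvT : v ∈ T := hli.subset_extend _ rfl
  have hT : Set.range b = T := Module.Basis.range_extend hli
  have : Finite T := Module.Finite.finite_basis b
  have hfin : T.Finite := Set.toFinite _
  have hcard : T.ncard = (maximalIdeal R).spanFinrank := by
    rw [spanFinrank_maximalIdeal_eq_finrank_cotangentSpace, Module.finrank_eq_nat_card_basis b]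
    rfl
  let g : V → maximalIdeal R := Function.surjInv hc
  have hg : ∀ w, c (g w) = w := Function.surjInv_eq hc
  let s : Set (maximalIdeal R) := insert ⟨x, hx⟩ (g '' (T \ {v}))
  have himg : c '' s = T := by
    rw [Set.image_insert_eq, Set.image_image]
    simp only [hg, Set.image_id']
    exact Set.insert_sdiff_self_of_mem hvT
  have hs : Submodule.span R s = ⊤ := by
    rw [← CotangentSpace.span_image_eq_top_iff]
    change Submodule.span _ (c '' s) = ⊤
    rw [himg, ← hT]
    exact b.span_eq
  let q := Ideal.Quotient.mk (Ideal.span {x})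
  have hspan : maximalIdeal R = Ideal.span (Subtype.val '' s) := by
    have := congrArg (Submodule.map (maximalIdeal R).subtype) hs
    rw [Submodule.map_span, Submodule.map_top, Submodule.range_subtype] at this
    exact this.symm
  have hmap : maximalIdeal (R ⧸ Ideal.span {x}) =
      Ideal.span ((fun w ↦ q (g w)) '' (T \ {v})) := by
    have h1 : (maximalIdeal R).map q = maximalIdeal (R ⧸ Ideal.span {x}) :=
      ((local_hom_TFAE q).out 0 4 rfl rfl).mp (.of_surjective q Ideal.Quotient.mk_surjective) ▸
        Ideal.map_comap_of_surjective q Ideal.Quotient.mk_surjective _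
    have h2 : (maximalIdeal R).map q = (Ideal.span (Subtype.val '' s)).map q :=
      congrArg (Ideal.map q) hspan
    rw [← h1, h2, Ideal.map_span]
    simp only [s, Set.image_insert_eq, Set.image_image]
    have : q x = 0 := Ideal.Quotient.eq_zero_iff_mem.mpr (Ideal.mem_span_singleton_self x)
    rw [this, Ideal.span_insert_zero]
  rw [hmap, ← hcard, ← Set.ncard_sdiff_singleton_add_one hvT hfin]
  gcongr
  exact (Submodule.spanFinrank_span_le_ncard_of_finite (hfin.sdiff.image _)).trans
    (Set.ncard_image_le hfin.sdiff)

/-- Induction on the embedding dimension. Prime avoidance gives `x ∈ 𝔪` outside `𝔪²` and outside all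
minimal primes; then `R/(x)` is regular of dimension one less, so `(x)` is prime. A minimal prime `q
⊆ (x)` does not contain `x`, hence `q = xq`, and Nakayama gives `q = 0`. -/
lemma IsRegularLocalRing.isDomain_aux (n : ℕ) : ∀ (R : Type u) [CommRing R] [IsRegularLocalRing R],
    (maximalIdeal R).spanFinrank = n → IsDomain R := by
  classical
  induction n with
  | zero =>
    intro R _ _ h
    have : maximalIdeal R = ⊥ :=
      (Submodule.spanFinrank_eq_zero_iff_eq_bot (IsNoetherian.noetherian _)).mp h
    exact (isField_iff_maximalIdeal_eq.mpr this).isDomain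
  | succ n ih =>
    intro R _ _ h
    have hdim : ringKrullDim R = (n + 1 : ℕ) := by
      rw [← h]; exact (IsRegularLocalRing.spanFinrank_maximalIdeal (R := R)).symm
    have hht : (maximalIdeal R).height = (n + 1 : ℕ) := by
      have := IsLocalRing.maximalIdeal_height_eq_ringKrullDim (R := R)
      rw [hdim] at this
      exact_mod_cast this
    have hfin := minimalPrimes.finite_of_isNoetherianRing R
    obtain ⟨x, hx, hxn⟩ : ∃ x ∈ maximalIdeal R,
        x ∉ ⋃ i ∈ (↑(insert (maximalIdeal R ^ 2) hfin.toFinset) : Set (Ideal R)), (i : Set R) := by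
      by_contra! hcon
      -- Prime avoidance allows two non-prime members; `𝔪²` fills both places.
      obtain ⟨i, hi, hle⟩ := (Ideal.subset_union_prime (f := id) (maximalIdeal R ^ 2)
        (maximalIdeal R ^ 2) (by
          intro i hi h1 _
          have := Finset.mem_of_mem_insert_of_ne hi h1
          exact (hfin.mem_toFinset.mp this).1.1)).mp hcon
      rcases Finset.mem_insert.mp hi with rfl | hi
      · have : maximalIdeal R = ⊥ := Submodule.eq_bot_of_le_smul_of_le_jacobson_bot
          (maximalIdeal R) (maximalIdeal R) (IsNoetherian.noetherian _)
          (by simpa [pow_two] using hle) (maximalIdeal_le_jacobson _)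
        rw [this, Submodule.spanFinrank_bot] at h
        omega
      · have hi' := hfin.mem_toFinset.mp hi
        have := hi'.1.1
        have h0 : (id i : Ideal R).height = 0 := by
          simp only [id]
          exact Ideal.height_eq_zero_iff.mpr hi'
        have := Ideal.height_mono hle
        rw [h0, hht] at this
        simp at this
    simp only [Finset.coe_insert, Set.Finite.coe_toFinset, Set.mem_insert_iff, Set.iUnion_iUnion_eq_or_left,
      Set.mem_union, Set.mem_iUnion, not_or, SetLike.mem_coe, not_exists] at hxn
    have hne : Ideal.span {x} ≠ ⊤ := by
      rw [Ne, Ideal.span_singleton_eq_top]; exact hx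
    have := Ideal.Quotient.nontrivial_iff.mpr hne
    have : IsLocalRing (R ⧸ Ideal.span {x}) :=
      .of_surjective' _ Ideal.Quotient.mk_surjective
    have hle := spanFinrank_maximalIdeal_quotient_span_singleton_lt hx hxn.1
    have hge := ringKrullDim_le_ringKrullDim_quotient_add_encard (R := R) {x} (by
      rw [IsLocalRing.ringJacobson_eq_maximalIdeal]; simpa using hx)
    have hle2 := ringKrullDim_le_spanFinrank_maximalIdeal (R := R ⧸ Ideal.span {x})
    have hn : (n : WithBot ℕ∞) ≤ ringKrullDim (R ⧸ Ideal.span {x}) := by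
      rw [hdim, Set.encard_singleton] at hge
      push_cast at hge
      revert hge
      generalize ringKrullDim (R ⧸ Ideal.span {x}) = d
      intro hge
      induction d using WithBot.recBotCoe with
      | bot => exact absurd hge (by rw [WithBot.bot_add]; exact not_le.mpr (WithBot.bot_lt_coe _))
      | coe d =>
        have hge' : (n : ℕ∞) + 1 ≤ d + 1 := by exact_mod_cast hge
        exact_mod_cast (ENat.add_le_add_iff_right (by simp)).mp hge'
    have hr : (maximalIdeal (R ⧸ Ideal.span {x})).spanFinrank = n := by
      have : n ≤ (maximalIdeal (R ⧸ Ideal.span {x})).spanFinrank := by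
        exact_mod_cast hn.trans hle2
      omega
    have : IsRegularLocalRing (R ⧸ Ideal.span {x}) :=
      .of_spanFinrank_maximalIdeal_le _ (by rw [hr]; exact hn)
    have := ih _ hr
    have hprime : (Ideal.span {x}).IsPrime := (Ideal.Quotient.isDomain_iff_prime _).mp this
    obtain ⟨q, hq, hqx⟩ := Ideal.exists_minimalPrimes_le (bot_le (a := Ideal.span {x}))
    have hxq : x ∉ q := hxn.2 q hq
    have hqp : q.IsPrime := hq.1.1
    have : q = ⊥ := by
      refine Submodule.eq_bot_of_le_smul_of_le_jacobson_bot (maximalIdeal R) q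
        (IsNoetherian.noetherian _) (fun y hy ↦ ?_) (maximalIdeal_le_jacobson _)
      obtain ⟨z, rfl⟩ := Ideal.mem_span_singleton'.mp (hqx hy)
      rw [mul_comm]
      exact Ideal.mul_mem_mul hx ((hqp.mem_or_mem hy).resolve_right hxq)
    subst this
    exact IsDomain.of_bot_isPrime R

/-- A regular local ring is a domain. -/
theorem IsRegularLocalRing.isDomain (R : Type*) [CommRing R] [IsRegularLocalRing R] : IsDomain R :=
  isDomain_aux _ R rfl

end RegularLocal

/-! ### Regularity of unramified flat algebras -/

section Etale

open IsLocalRing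

/-- If `E` is flat over a regular ring `C` and unramified at `P`, then `E_P` is regular,
of dimension the height of the contraction of `P`. -/
theorem IsRegularLocalRing.of_flat_of_isUnramifiedAt {C E : Type*} [CommRing C] [CommRing E]
    [Algebra C E] [IsRegularRing C] [Algebra.EssFiniteType C E] [Module.Flat C E]
    (P : Ideal E) [P.IsPrime] [Algebra.IsUnramifiedAt C P] :
    IsRegularLocalRing (Localization.AtPrime P) ∧
      ringKrullDim (Localization.AtPrime P) = (P.under C).height := by
  have : IsNoetherianRing E := Algebra.EssFiniteType.isNoetherianRing C E
  let p := P.under C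
  let := Localization.AtPrime.algebraOfLiesOver p P
  have : Localization.AtPrime.IsLiesOverAlgebra p P := ⟨rfl⟩
  -- Unramifiedness makes `p` generate the maximal ideal of `E_P`, so the embedding dimension is at
  -- most `ht p`. Going-down for flat maps gives `ht p ≤ ht P = dim E_P`, and the inequalities close
  -- up.
  have hmap := ((Algebra.isUnramifiedAt_iff_map_eq C p P).mp inferInstance).2
  have hmap' : maximalIdeal (Localization.AtPrime P) = (maximalIdeal (Localization.AtPrime p)).map
      (algebraMap (Localization.AtPrime p) (Localization.AtPrime P)) := by
    rw [← hmap, ← Localization.AtPrime.map_eq_maximalIdeal, Ideal.map_map]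
    congr 1
    rw [Localization.AtPrime.IsLiesOverAlgebra.algebraMap_eq, Localization.localRingHom,
      IsLocalization.map_comp, ← IsScalarTower.algebraMap_eq]
  have hreg : IsRegularLocalRing (Localization.AtPrime p) := inferInstance
  have h1 : (maximalIdeal (Localization.AtPrime P)).spanFinrank ≤
      (maximalIdeal (Localization.AtPrime p)).spanFinrank := by
    rw [hmap']; exact Ideal.spanFinrank_map_le_of_fg _ (IsNoetherian.noetherian _)
  have h2 : ((maximalIdeal (Localization.AtPrime p)).spanFinrank : WithBot ℕ∞) = p.height := by
    rw [hreg.spanFinrank_maximalIdeal, IsLocalization.AtPrime.ringKrullDim_eq_height p]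
  have h3 : ringKrullDim (Localization.AtPrime P) = P.height :=
    IsLocalization.AtPrime.ringKrullDim_eq_height P _
  have h4 : (p.height : WithBot ℕ∞) ≤ P.height := by
    have := Ideal.height_eq_height_add_of_liesOver_of_hasGoingDown p P
    rw [this]
    exact_mod_cast le_self_add
  have h5 : ((maximalIdeal (Localization.AtPrime P)).spanFinrank : WithBot ℕ∞) ≤ p.height := by
    rw [← h2]; exact_mod_cast h1
  have hR : IsRegularLocalRing (Localization.AtPrime P) :=
    .of_spanFinrank_maximalIdeal_le _ (by rw [h3]; exact h5.trans h4)
  refine ⟨hR, le_antisymm ?_ (h3 ▸ h4)⟩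
  rw [← hR.spanFinrank_maximalIdeal]
  exact h5

end Etale

end

section

open IsLocalRing

/-! ### Unramified algebras as quotients of étale ones -/

section Unramified

/-- Locally, an unramified algebra is a quotient of an étale one. -/
lemma Algebra.IsUnramifiedAt.exists_etale_surjective {C A : Type u} [CommRing C] [CommRing A]
    [Algebra C A] [Algebra.FiniteType C A] (p : Ideal A) [p.IsPrime]
    [Algebra.IsUnramifiedAt C p] :
    ∃ (E : Type u) (_ : CommRing E) (_ : Algebra C E) (_ : Algebra.Etale C E) (P : Ideal E)
      (_ : P.IsPrime) (g : Localization.AtPrime P →ₐ[C] Localization.AtPrime p),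
      Function.Surjective g ∧ P.under C = p.under C := by
  obtain ⟨f, hf, S, φ, hφ⟩ :=
    Algebra.IsUnramifiedAt.exists_hasStandardEtaleSurjectionOn (R := C) p
  let Ap := Localization.AtPrime p
  have hunit : ∀ y : Submonoid.powers f, IsUnit (algebraMap A Ap y) := by
    rintro ⟨_, n, rfl⟩
    exact IsLocalization.map_units Ap (⟨f ^ n, fun h ↦ hf (‹p.IsPrime›.mem_of_pow_mem n h)⟩ :
      p.primeCompl)
  let ψ : Localization.Away f →ₐ[C] Ap :=
    { IsLocalization.lift (M := Submonoid.powers f) hunit with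
      commutes' := fun c ↦ by
        simp only [RingHom.toMonoidHom_eq_coe, OneHom.toFun_eq_coe, MonoidHom.toOneHom_coe,
          MonoidHom.coe_coe]
        rw [IsScalarTower.algebraMap_apply C A (Localization.Away f), IsLocalization.lift_eq,
          ← IsScalarTower.algebraMap_apply] }
  have hψ : ∀ a : A, ψ (algebraMap A _ a) = algebraMap A Ap a := fun a ↦
    IsLocalization.lift_eq hunit a
  let χ : S.Ring →ₐ[C] Ap := ψ.comp φ
  -- The standard étale ring surjects onto `A_f` with `f ∉ p`. After localizing at the preimage of
  -- the maximal ideal the map stays surjective, since numerators and denominators both lift.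
  let P : Ideal S.Ring := (maximalIdeal Ap).comap χ
  have hP : P.IsPrime := inferInstance
  have hχ : ∀ y : P.primeCompl, IsUnit (χ y) := fun y ↦ by
    have := y.2
    by_contra h
    exact this ((mem_maximalIdeal _).mpr h)
  let g : Localization.AtPrime P →ₐ[C] Ap :=
    { IsLocalization.lift (M := P.primeCompl) (g := χ.toRingHom) hχ with
      commutes' := fun c ↦ by
        simp only [RingHom.toMonoidHom_eq_coe, OneHom.toFun_eq_coe, MonoidHom.toOneHom_coe,
          MonoidHom.coe_coe]
        rw [IsScalarTower.algebraMap_apply C S.Ring (Localization.AtPrime P),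
          IsLocalization.lift_eq]
        exact χ.commutes c }
  have hg : ∀ e : S.Ring, g (algebraMap _ _ e) = χ e := fun e ↦
    IsLocalization.lift_eq (g := χ.toRingHom) hχ e
  refine ⟨S.Ring, inferInstance, inferInstance, inferInstance, P, hP, g, ?_, ?_⟩
  · intro y
    obtain ⟨a, s, rfl⟩ := IsLocalization.exists_mk'_eq p.primeCompl y
    obtain ⟨e, he⟩ := hφ (algebraMap A _ a)
    obtain ⟨e', he'⟩ := hφ (algebraMap A _ s)
    have h1 : χ e = algebraMap A Ap a := by simp [χ, he, hψ]
    have h2 : χ e' = algebraMap A Ap s := by simp [χ, he', hψ]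
    have he'P : e' ∈ P.primeCompl := by
      intro h
      have : χ e' ∈ maximalIdeal Ap := h
      rw [h2, mem_maximalIdeal] at this
      exact this (IsLocalization.map_units Ap s)
    refine ⟨IsLocalization.mk' _ e ⟨e', he'P⟩, ?_⟩
    rw [IsLocalization.eq_mk'_iff_mul_eq, ← h2, ← h1, ← hg, ← hg, ← map_mul]
    congr 1
    exact IsLocalization.mk'_spec _ e ⟨e', he'P⟩
  · ext c
    simp only [P, Ideal.under_def, Ideal.mem_comap]
    rw [show χ (algebraMap C S.Ring c) = algebraMap A Ap (algebraMap C A c) by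
      rw [AlgHom.commutes, ← IsScalarTower.algebraMap_apply]]
    exact IsLocalization.AtPrime.to_map_mem_maximal_iff Ap p _

/-- The localization of an étale algebra over a polynomial ring over a field is formally smooth. -/
lemma Algebra.FormallySmooth.localization_of_etale_mvPolynomial (k : Type u) [Field k] {σ : Type u}
    {E : Type u} [CommRing E] [Algebra (MvPolynomial σ k) E] [Algebra k E]
    [IsScalarTower k (MvPolynomial σ k) E]
    [Algebra.Etale (MvPolynomial σ k) E] (P : Ideal E) [P.IsPrime] :
    Algebra.FormallySmooth k (Localization.AtPrime P) := by
  have h1 : Algebra.FormallySmooth k E := .comp k (MvPolynomial σ k) E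
  have h2 : Algebra.FormallySmooth E (Localization.AtPrime P) := .of_isLocalization P.primeCompl
  exact .comp k E _

end Unramified

/-! ### Regular implies smooth over a perfect field -/

section RegularToSmooth

variable {k : Type u} [Field k] [PerfectField k] {A : Type u} [CommRing A] [Algebra k A]
  [Algebra.FiniteType k A]

/-- Over a perfect field, an algebra of finite type is smooth at the closed points where it is
regular. -/
theorem Algebra.IsSmoothAt.of_isRegularLocalRing (m : Ideal A) [m.IsMaximal]
    [IsRegularLocalRing (Localization.AtPrime m)] : Algebra.IsSmoothAt k m := by
  classical
  let B := Localization.AtPrime m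
  let n := (maximalIdeal B).spanFinrank
  -- A minimal system of generators, with denominators cleared so that it comes from `A`; this
  -- changes each generator only by a unit.
  obtain ⟨a, ham, hspan⟩ : ∃ a : ULift.{u} (Fin n) → A, (∀ i, a i ∈ m) ∧
      Ideal.span (Set.range fun i ↦ algebraMap A B (a i)) = maximalIdeal B := by
    have hfg : (maximalIdeal B).FG := IsNoetherian.noetherian _
    have hcard := Submodule.FG.generators_ncard hfg
    have hfin := Submodule.FG.finite_generators hfg
    have hsp : Ideal.span (maximalIdeal B).generators = maximalIdeal B :=
      (maximalIdeal B).span_generators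
    have : Nat.card (maximalIdeal B).generators = n := hcard
    have := hfin.to_subtype
    let e : Fin n ≃ (maximalIdeal B).generators :=
      (Finite.equivFinOfCardEq hcard).symm
    have hex : ∀ i : Fin n, ∃ x : A, ∃ s : m.primeCompl, (e i : B) = IsLocalization.mk' B x s :=
      fun i ↦ by
        obtain ⟨x, s, h⟩ := IsLocalization.exists_mk'_eq m.primeCompl (e i : B)
        exact ⟨x, s, h.symm⟩
    choose x s hx using hex
    have hspan : Ideal.span (Set.range fun i : ULift.{u} (Fin n) ↦ algebraMap A B (x i.down)) =
        maximalIdeal B := by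
      refine le_antisymm ?_ ?_
      · rw [Ideal.span_le]
        rintro _ ⟨i, rfl⟩
        have h1 : (e i.down : B) ∈ maximalIdeal B := hsp.le (Ideal.subset_span (e i.down).2)
        have h2 : algebraMap A B (x i.down) = e i.down * algebraMap A B (s i.down) := by
          rw [hx, IsLocalization.mk'_spec]
        simp only [h2]
        exact Ideal.mul_mem_right _ _ h1
      · rw [← hsp, Ideal.span_le]
        intro y hy
        obtain ⟨i, hi⟩ := e.surjective ⟨y, hy⟩
        have h1 : y = algebraMap A B (x i) * IsLocalization.mk' B 1 (s i) := by
          rw [← IsLocalization.mk'_eq_mul_mk'_one, ← hx, hi]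
        rw [h1]
        exact Ideal.mul_mem_right _ _ (Ideal.subset_span ⟨⟨i⟩, rfl⟩)
    refine ⟨fun i ↦ x i.down, fun i ↦ ?_, hspan⟩
    rw [← IsLocalization.AtPrime.to_map_mem_maximal_iff B m, ← hspan]
    exact Ideal.subset_span ⟨i, rfl⟩
  let C := MvPolynomial (ULift.{u} (Fin n)) k
  let : Algebra C A := (MvPolynomial.aeval a).toAlgebra
  have hX : ∀ i, algebraMap C A (MvPolynomial.X i) = a i := fun i ↦ MvPolynomial.aeval_X a i
  have : IsScalarTower k C A := .of_algHom (MvPolynomial.aeval a)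
  have : Algebra.FiniteType C A := .of_restrictScalars_finiteType k C A
  let p := m.under C
  let := Localization.AtPrime.algebraOfLiesOver p m
  have : Localization.AtPrime.IsLiesOverAlgebra p m := ⟨rfl⟩
  have hunr : Algebra.IsUnramifiedAt C m := by
    rw [Algebra.isUnramifiedAt_iff_map_eq C p m]
    constructor
    -- The residue field is finite over `k` by the Nullstellensatz, hence separable because `k` is
    -- perfect.
    · let := Ideal.Quotient.field m
      have h1 : Module.Finite k (A ⧸ m) := finite_of_finite_type_of_isJacobsonRing k (A ⧸ m)
      have h2 : Module.Finite k m.ResidueField := by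
        let f : (A ⧸ m) →ₐ[k] m.ResidueField := IsScalarTower.toAlgHom k (A ⧸ m) m.ResidueField
        exact Module.Finite.of_surjective f.toLinearMap
          (Ideal.bijective_algebraMap_quotient_residueField m).2
      exact Algebra.isSeparable_tower_top_of_isSeparable k p.ResidueField m.ResidueField
    · refine le_antisymm ?_ ?_
      · rw [Ideal.map_le_iff_le_comap]
        intro c hc
        rw [Ideal.mem_comap, IsScalarTower.algebraMap_apply C A B,
          IsLocalization.AtPrime.to_map_mem_maximal_iff B m]
        exact hc
      · rw [← hspan, Ideal.span_le]
        rintro _ ⟨i, rfl⟩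
        simp only [← hX, ← IsScalarTower.algebraMap_apply C A B]
        refine Ideal.mem_map_of_mem _ ?_
        change algebraMap C A _ ∈ m
        rw [hX]; exact ham i
  obtain ⟨E, _, _, _, P, _, g, hg, hPp⟩ :=
    Algebra.IsUnramifiedAt.exists_etale_surjective (C := C) m
  obtain ⟨hreg, hdim⟩ := IsRegularLocalRing.of_flat_of_isUnramifiedAt (C := C) P
  have := hreg.isDomain
  have hC : ringKrullDim C = n := by
    rw [MvPolynomial.ringKrullDim_of_isNoetherianRing, ringKrullDim_eq_zero_of_field]
    simp
  have hB : ringKrullDim B = n := (IsRegularLocalRing.spanFinrank_maximalIdeal (R := B)).symm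
  have hle : ringKrullDim (Localization.AtPrime P) ≤ n := by
    rw [hdim, ← hC]; exact Ideal.height_le_ringKrullDim_of_ne_top Ideal.IsPrime.ne_top'
  -- A nonzero kernel element is a nonzerodivisor in the domain `E_P`, so its quotient `B` would
  -- have dimension below `n`; but `dim B = n`.
  have hinj : Function.Injective g := by
    rw [injective_iff_map_eq_zero]
    by_contra! hcon
    obtain ⟨y, hy, hy0⟩ := hcon
    have h := ringKrullDim_succ_le_of_surjective g.toRingHom hg
      (mem_nonZeroDivisors_of_ne_zero hy0) hy
    have h2 := h.trans hle
    change ringKrullDim B + 1 ≤ _ at h2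
    rw [hB] at h2
    have h3 : n + 1 ≤ n := by exact_mod_cast h2
    omega
  let : Algebra k E := ((algebraMap C E).comp (algebraMap k C)).toAlgebra
  have : IsScalarTower k C E := .of_algebraMap_eq' rfl
  have h0 : Algebra.FormallySmooth k (Localization.AtPrime P) :=
    Algebra.FormallySmooth.localization_of_etale_mvPolynomial k (σ := ULift.{u} (Fin n)) P
  have : IsScalarTower k C (Localization.AtPrime P) := by
    refine .of_algebraMap_eq fun c ↦ ?_
    rw [IsScalarTower.algebraMap_apply k E, IsScalarTower.algebraMap_apply k C E,
      ← IsScalarTower.algebraMap_apply C E]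
  exact .of_equiv ((AlgEquiv.ofBijective g ⟨hinj, hg⟩).restrictScalars k)

/-- Over a perfect field, a regular algebra of finite type is smooth. -/
theorem Algebra.Smooth.of_isRegularLocalRing
    (h : ∀ (p : Ideal A) [p.IsPrime], IsRegularLocalRing (Localization.AtPrime p)) :
    Algebra.Smooth k A := by
  have hfp : Algebra.FinitePresentation k A := Algebra.FinitePresentation.of_finiteType.mp ‹_›
  refine ⟨?_, hfp⟩
  rw [← Algebra.smoothLocus_eq_univ_iff]
  by_contra hne
  obtain ⟨x, hx⟩ := (Set.ne_univ_iff_exists_notMem _).mp hne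
  obtain ⟨M, hM, hle⟩ := Ideal.exists_le_maximal x.asIdeal x.2.ne_top
  have := h M
  have hMs : (⟨M, hM.isPrime⟩ : PrimeSpectrum A) ∈ Algebra.smoothLocus k A :=
    Algebra.IsSmoothAt.of_isRegularLocalRing (k := k) M
  refine hx ?_
  -- The smooth locus is open and contains a specialization of `x`, so it contains `x`.
  exact (PrimeSpectrum.le_iff_specializes x ⟨M, hM.isPrime⟩ |>.mp hle).mem_open
    Algebra.isOpen_smoothLocus hMs

end RegularToSmooth

end

section

open IsLocalRing

/-! ### Flat differentials imply regular -/

section FlatToRegular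

open scoped TensorProduct

/-- If the values of `x : κ → A` generate `Ω[A⁄k]`, they generate `Ω[B⁄k]` for any
localization `B` of `A`. -/
lemma KaehlerDifferential.span_D_of_isLocalization {k A B κ : Type*} [CommRing k] [CommRing A]
    [CommRing B] [Algebra k A] [Algebra k B] [Algebra A B] [IsScalarTower k A B]
    (M : Submonoid A) [IsLocalization M B] (x : κ → A)
    (hx : Submodule.span A (Set.range fun i ↦ D k A (x i)) = ⊤) :
    Submodule.span B (Set.range fun i ↦ D k B (algebraMap A B (x i))) = ⊤ := by
  have := span_eq_top_of_isLocalizedModule B M (map k k A B) hx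
  rw [← Set.range_comp] at this
  simpa [Function.comp_def] using this

/-- Let `g : L → B` be a surjection from a Noetherian domain to a reduced ring, over a perfect
field. If a family generates `Ω[L⁄k]` and becomes a basis of `Ω[B⁄k]`, then `g` is injective. -/
theorem KaehlerDifferential.injective_of_surjective_of_basis {k L B κ : Type*} [Field k]
    [PerfectField k] [CommRing L] [IsDomain L] [IsNoetherianRing L] [CommRing B] [IsReduced B]
    [Nontrivial B] [Algebra k L] [Algebra.FormallySmooth k L] [Algebra k B]
    [Algebra.EssFiniteType k B]
    [Algebra L B] [IsScalarTower k L B]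
    (hg : Function.Surjective (algebraMap L B)) (x : κ → L)
    (hx : Submodule.span L (Set.range fun i ↦ D k L (x i)) = ⊤)
    (b : Module.Basis κ B Ω[B⁄k]) (hb : ∀ i, b i = D k B (algebraMap L B (x i))) :
    Function.Injective (algebraMap L B) := by
  -- Injectivity can be tested at a generic point: `B_q` is a field because `B` is reduced, and it
  -- is formally smooth over `k` because `k` is perfect. The domain `L` embeds in its localization
  -- at the preimage of `q`.
  obtain ⟨q, hq⟩ := Ideal.nonempty_minimalPrimes (I := (⊥ : Ideal B)) bot_ne_top
  have hqp : q.IsPrime := hq.1.1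
  let K := Localization.AtPrime q
  have hred : IsReduced K := inferInstance
  have hK : IsField K := by
    rw [isField_iff_maximalIdeal_eq, eq_bot_iff]
    intro y hy
    rw [Ideal.mem_bot]
    refine IsNilpotent.eq_zero (mem_nilradical.mp ?_)
    rw [nilradical_eq_sInf, Ideal.mem_sInf]
    intro J hJ
    have hJ : J.IsPrime := hJ
    have hle : J.under B ≤ q := (Ideal.comap_mono (le_maximalIdeal hJ.ne_top)).trans
      (IsLocalization.AtPrime.under_maximalIdeal K q).le
    have h1 : q ≤ J.under B := hq.2 ⟨inferInstance, bot_le⟩ hle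
    rw [← Localization.AtPrime.map_eq_maximalIdeal] at hy
    exact Ideal.map_le_iff_le_comap.mpr h1 hy
  let : Field K := hK.toField
  let Q := q.comap (algebraMap L B)
  let L' := Localization.AtPrime Q
  let g' : L' →+* K := Localization.localRingHom Q q (algebraMap L B) rfl
  have hgg' : ∀ l : L, g' (algebraMap L L' l) = algebraMap B K (algebraMap L B l) := fun l ↦
    Localization.localRingHom_to_map Q q (algebraMap L B) rfl l
  let : Algebra L' K := g'.toAlgebra
  have hg' : Function.Surjective (algebraMap L' K) := by
    intro y
    obtain ⟨c, s, rfl⟩ := IsLocalization.exists_mk'_eq q.primeCompl y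
    obtain ⟨l, rfl⟩ := hg c
    obtain ⟨t, ht⟩ := hg s
    have htQ : t ∈ Q.primeCompl := fun h ↦ s.2 (by rw [← ht]; exact h)
    refine ⟨IsLocalization.mk' L' l ⟨t, htQ⟩, ?_⟩
    change g' _ = _
    rw [IsLocalization.eq_mk'_iff_mul_eq, ← ht, ← hgg', ← hgg', ← map_mul]
    congr 1
    exact IsLocalization.mk'_spec _ l ⟨t, htQ⟩
  have : IsScalarTower k L' K := .of_algebraMap_eq fun c ↦ by
    change _ = g' _
    rw [IsScalarTower.algebraMap_apply k L L', hgg', ← IsScalarTower.algebraMap_apply k L B,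
      ← IsScalarTower.algebraMap_apply k B K]
  have : Algebra.EssFiniteType B K := .of_isLocalization K q.primeCompl
  have : Algebra.EssFiniteType k K := .comp k B K
  have : Algebra.FormallySmooth L L' := .of_isLocalization Q.primeCompl
  have : Algebra.FormallySmooth k L' := .comp k L L'
  have hsm : Algebra.FormallySmooth k K := inferInstance
  let bK : Module.Basis κ K Ω[K⁄k] := b.ofIsLocalizedModule K q.primeCompl (map k k B K)
  have hbK : ∀ i, bK i = D k K (algebraMap L' K (algebraMap L L' (x i))) := fun i ↦ by
    have h2 : algebraMap L' K (algebraMap L L' (x i)) = algebraMap B K (algebraMap L B (x i)) :=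
      hgg' _
    rw [h2, Module.Basis.ofIsLocalizedModule_apply K q.primeCompl (map k k B K) b i, hb, map_D]
  have hspan := span_D_of_isLocalization (B := L') Q.primeCompl x hx
  let v : κ → K ⊗[L'] Ω[L'⁄k] := fun i ↦ 1 ⊗ₜ D k L' (algebraMap L L' (x i))
  have hv : Submodule.span K (Set.range v) = ⊤ := by
    have h := Submodule.baseChange_span (R := L') (A := K)
      (Set.range fun i ↦ D k L' (algebraMap L L' (x i)))
    rw [hspan, Submodule.baseChange_top, ← Set.range_comp] at h
    exact h.symm
  let F : K ⊗[L'] Ω[L'⁄k] →ₗ[K] Ω[K⁄k] := mapBaseChange k L' K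
  -- The generators `v i` are sent to a basis, so they satisfy no relation.
  have hF : Function.Injective F := by
    rw [injective_iff_map_eq_zero]
    intro y hy
    have hy' : y ∈ Submodule.span K (Set.range v) := hv ▸ Submodule.mem_top
    obtain ⟨c, rfl⟩ := (Finsupp.mem_span_range_iff_exists_finsupp).mp hy'
    rw [map_finsuppSum] at hy
    have hc : Finsupp.linearCombination K bK c = 0 := by
      rw [Finsupp.linearCombination_apply, ← hy]
      refine Finsupp.sum_congr fun i _ ↦ ?_
      rw [map_smul]
      simp only [F, v, mapBaseChange_tmul, map_D, one_smul, hbK]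
    have := (linearIndependent_iff.mp bK.linearIndependent) c hc
    rw [this, Finsupp.sum_zero_index]
  -- With `J` the kernel of `L' → K`, smoothness of `K` makes `J/J² → K ⊗ Ω[L'⁄k]` split injective.
  -- Its composite with the injective `F` vanishes, so `J = J²` and Nakayama gives `J = 0`.
  obtain ⟨l, hl⟩ := (Algebra.FormallySmooth.iff_split_injection (R := k) hg').mp hsm
  have hker : RingHom.ker (algebraMap L' K) = ⊥ := by
    refine Submodule.eq_bot_of_le_smul_of_le_jacobson_bot (RingHom.ker (algebraMap L' K)) _
      (IsNoetherian.noetherian _) (fun z hz ↦ ?_)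
      ((le_maximalIdeal (RingHom.ker_ne_top _)).trans (maximalIdeal_le_jacobson _))
    have h1 : kerCotangentToTensor k L' K (Ideal.toCotangent _ ⟨z, hz⟩) = 0 := by
      apply hF
      rw [kerCotangentToTensor_toCotangent, map_zero]
      simp only [F, mapBaseChange_tmul, map_D, one_smul]
      rw [RingHom.mem_ker.mp hz, map_zero]
    have h2 : Ideal.toCotangent (RingHom.ker (algebraMap L' K)) ⟨z, hz⟩ = 0 := by
      have := congrArg l h1
      rw [map_zero, ← LinearMap.comp_apply, hl] at this
      exact this
    rw [smul_eq_mul, ← pow_two]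
    exact (Ideal.toCotangent_eq_zero _ _).mp h2
  have hinj : Function.Injective (algebraMap L L') :=
    IsLocalization.injective L' (Ideal.primeCompl_le_nonZeroDivisors Q)
  rw [injective_iff_map_eq_zero]
  intro y hy
  apply hinj
  rw [map_zero]
  have : algebraMap L L' y ∈ RingHom.ker (algebraMap L' K) := by
    rw [RingHom.mem_ker]
    change g' _ = 0
    rw [hgg', hy, map_zero]
  rwa [hker] at this

variable {k : Type u} [Field k] [PerfectField k] {A : Type u} [CommRing A] [Algebra k A]
  [Algebra.FiniteType k A]

/-- Over a perfect field, a reduced algebra of finite type with flat module of differentials is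
regular. -/
theorem IsRegularLocalRing.of_flat_kaehlerDifferential [IsReduced A] [Module.Flat A Ω[A⁄k]]
    (p : Ideal A) [p.IsPrime] : IsRegularLocalRing (Localization.AtPrime p) := by
  let B := Localization.AtPrime p
  have : IsNoetherianRing A := Algebra.FiniteType.isNoetherianRing k A
  have : Module.Finite B Ω[B⁄k] := by
    have : Algebra.EssFiniteType k B := .comp k A B
    infer_instance
  have : Module.FinitePresentation B Ω[B⁄k] := Module.finitePresentation_of_finite _ _
  have : Module.Flat B Ω[B⁄k] := Module.Flat.of_isLocalizedModule B p.primeCompl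
    (KaehlerDifferential.map k k A B)
  have hA : Submodule.span B (Set.range fun a : A ↦ KaehlerDifferential.D k B (algebraMap A B a)) =
      ⊤ := KaehlerDifferential.span_D_of_isLocalization p.primeCompl id
        (KaehlerDifferential.span_range_derivation k A)
  -- A finitely presented flat module over a local ring is free, and a basis can be picked among the
  -- generators `da`. These `a` are the coordinates that make `A` unramified over a polynomial ring
  -- at `p`.
  obtain ⟨κ, a, b, hb⟩ := Module.exists_basis_of_span_of_flat _ hA
  have : Finite κ := Module.Finite.finite_basis b
  let C := MvPolynomial κ k
  let : Algebra C A := (MvPolynomial.aeval a).toAlgebra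
  have hX : ∀ i, algebraMap C A (MvPolynomial.X i) = a i := fun i ↦ MvPolynomial.aeval_X a i
  have : IsScalarTower k C A := .of_algHom (MvPolynomial.aeval a)
  have : Algebra.FiniteType C A := .of_restrictScalars_finiteType k C A
  have : IsScalarTower k C B := .to₁₂₄ k C A B
  have hunr : Algebra.IsUnramifiedAt C p := by
    constructor
    rw [← Submodule.subsingleton_iff B,
      ← subsingleton_iff_bot_eq_top, eq_comm]
    have hs := KaehlerDifferential.map_surjective k C B
    have := congrArg (Submodule.map (KaehlerDifferential.map k C B B)) b.span_eq
    rw [Submodule.map_top, LinearMap.range_eq_top.mpr hs, Submodule.map_span, ← Set.range_comp]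
      at this
    rw [← this, Submodule.span_eq_bot]
    rintro _ ⟨i, rfl⟩
    simp only [Function.comp_apply, hb, KaehlerDifferential.map_D, Algebra.algebraMap_self,
      RingHom.id_apply]
    rw [← hX, ← IsScalarTower.algebraMap_apply C A B, Derivation.map_algebraMap]
  obtain ⟨E, _, _, _, P, _, g, hg, hPp⟩ :=
    Algebra.IsUnramifiedAt.exists_etale_surjective (C := C) p
  obtain ⟨hreg, -⟩ := IsRegularLocalRing.of_flat_of_isUnramifiedAt (C := C) P
  let L := Localization.AtPrime P
  have := hreg.isDomain
  let : Algebra k E := ((algebraMap C E).comp (algebraMap k C)).toAlgebra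
  have : IsScalarTower k C E := .of_algebraMap_eq' rfl
  have : IsScalarTower k C L := .of_algebraMap_eq fun c ↦ by
    rw [IsScalarTower.algebraMap_apply k E, IsScalarTower.algebraMap_apply k C E,
      ← IsScalarTower.algebraMap_apply C E]
  have hsmL : Algebra.FormallySmooth k L :=
    Algebra.FormallySmooth.localization_of_etale_mvPolynomial k (σ := κ) P
  let : Algebra L B := g.toRingHom.toAlgebra
  have hCL : ∀ c : C, algebraMap L B (algebraMap C L c) = algebraMap C B c := fun c ↦ g.commutes c
  have : IsScalarTower k L B := .of_algebraMap_eq fun c ↦ by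
    rw [IsScalarTower.algebraMap_apply k C L, hCL, ← IsScalarTower.algebraMap_apply k C B]
  have hunrL : Subsingleton Ω[L⁄C] := Algebra.FormallyUnramified.subsingleton_kaehlerDifferential
  have hspan : Submodule.span L (Set.range fun i : κ ↦
      KaehlerDifferential.D k L (algebraMap C L (MvPolynomial.X i))) = ⊤ := by
    have hex := KaehlerDifferential.exact_mapBaseChange_map k C L
    have hsurj : Function.Surjective (KaehlerDifferential.mapBaseChange k C L) := fun y ↦
      (hex y).mp (Subsingleton.elim _ _)
    have h1 := Submodule.baseChange_span (R := C) (A := L)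
      (Set.range fun i : κ ↦ KaehlerDifferential.D k C (MvPolynomial.X i))
    have h2 : Submodule.span C (Set.range fun i : κ ↦
        KaehlerDifferential.D k C (MvPolynomial.X i)) = ⊤ := by
      have := (KaehlerDifferential.mvPolynomialBasis k κ).span_eq
      convert this using 3
      exact funext fun i ↦ (KaehlerDifferential.mvPolynomialBasis_apply k κ i).symm
    rw [h2, Submodule.baseChange_top, ← Set.range_comp] at h1
    have h3 := congrArg (Submodule.map (KaehlerDifferential.mapBaseChange k C L)) h1
    rw [Submodule.map_top, LinearMap.range_eq_top.mpr hsurj, Submodule.map_span,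
      ← Set.range_comp] at h3
    rw [h3]
    congr 2
    ext i
    simp [KaehlerDifferential.mapBaseChange_tmul]
  have hEss : Algebra.EssFiniteType k B := .comp k A B
  have hred : IsReduced B := inferInstance
  have hinj := KaehlerDifferential.injective_of_surjective_of_basis (k := k) (L := L) (B := B) hg
    (fun i ↦ algebraMap C L (MvPolynomial.X i)) hspan b (fun i ↦ by
      rw [hb, hCL, IsScalarTower.algebraMap_apply C A B, hX])
  exact .of_ringEquiv (RingEquiv.ofBijective (algebraMap L B) ⟨hinj, hg⟩)

end FlatToRegular

end

/-! ### Weil restriction of affine schemes -/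

section WeilRestriction

open scoped TensorProduct

variable {k : Type u} [Field k]

/-- A homomorphism `υ : A → R ⊗ D` of `k`-algebras is universal if every homomorphism
`A → B ⊗ D` is obtained from it by a unique homomorphism `R → B`: then `R` is the coordinate ring
of the Weil restriction along `D` of `Spec A ×ₖ Spec D`. -/
def AlgHom.IsUniversalFamily {A R D : Type u} [CommRing A] [CommRing R] [CommRing D] [Algebra k A]
    [Algebra k R] [Algebra k D] (υ : A →ₐ[k] R ⊗[k] D) : Prop :=
  ∀ (B : Type u) [CommRing B] [Algebra k B], Function.Bijective
    fun φ : R →ₐ[k] B ↦ (Algebra.TensorProduct.map φ (AlgHom.id k D)).comp υ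

lemma Algebra.TensorProduct.basis_repr_map {B B' D κ : Type*} [CommRing B] [CommRing B']
    [CommRing D] [Algebra k B] [Algebra k B'] [Algebra k D] (b : Module.Basis κ k D)
    (φ : B →ₐ[k] B') (z : B ⊗[k] D) (j : κ) :
    (Algebra.TensorProduct.basis B' b).repr (Algebra.TensorProduct.map φ (AlgHom.id k D) z) j =
      φ ((Algebra.TensorProduct.basis B b).repr z j) := by
  induction z with
  | zero => simp
  | add x y hx hy => simp [hx, hy]
  | tmul x y => simp [Algebra.TensorProduct.basis_repr_tmul]

/-- Weil restrictions along finite extensions exist for algebras of finite type. -/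
theorem AlgHom.exists_isUniversalFamily (A D : Type u) [CommRing A] [CommRing D] [Algebra k A]
    [Algebra k D] [Algebra.FiniteType k A] [Module.Finite k D] :
    ∃ (R : Type u) (_ : CommRing R) (_ : Algebra k R) (υ : A →ₐ[k] R ⊗[k] D),
      υ.IsUniversalFamily ∧ Algebra.FiniteType k R := by
  obtain ⟨n, π, hπ⟩ := Algebra.FiniteType.iff_quotient_mvPolynomial''.mp ‹Algebra.FiniteType k A›
  let b := Module.finBasis k D
  let κ := Fin (Module.finrank k D)
  let P := MvPolynomial (Fin n × κ) k
  let Υ : MvPolynomial (Fin n) k →ₐ[k] P ⊗[k] D :=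
    MvPolynomial.aeval fun i ↦ ∑ j : κ, (MvPolynomial.X (i, j) : P) ⊗ₜ b j
  -- Each variable is replaced by a generic combination of the basis of `D`; `N` collects the
  -- coordinates of all relations of `A` after this substitution.
  let N : Ideal P := Ideal.span {x | ∃ f, π f = 0 ∧ ∃ j : κ,
    x = (Algebra.TensorProduct.basis P b).repr (Υ f) j}
  let R := P ⧸ N
  let Ψ : MvPolynomial (Fin n) k →ₐ[k] R ⊗[k] D :=
    (Algebra.TensorProduct.map (Ideal.Quotient.mkₐ k N) (AlgHom.id k D)).comp Υ
  have hΨ : ∀ f ∈ RingHom.ker π, Ψ f = 0 := by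
    intro f hf
    apply (Algebra.TensorProduct.basis R b).repr.injective
    ext j
    rw [map_zero]
    simp only [Ψ, AlgHom.comp_apply, Algebra.TensorProduct.basis_repr_map]
    exact Ideal.Quotient.eq_zero_iff_mem.mpr (Ideal.subset_span ⟨f, hf, j, rfl⟩)
  let υ : A →ₐ[k] R ⊗[k] D := (Ideal.Quotient.liftₐ (RingHom.ker π) Ψ hΨ).comp
    (Ideal.quotientKerAlgEquivOfSurjective hπ).symm.toAlgHom
  have hυ : ∀ f, υ (π f) = Ψ f := by
    intro f
    have h : (Ideal.quotientKerAlgEquivOfSurjective hπ).symm (π f) =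
        Ideal.Quotient.mk (RingHom.ker π) f := by
      rw [AlgEquiv.symm_apply_eq]; rfl
    change (Ideal.Quotient.liftₐ (RingHom.ker π) Ψ hΨ)
      ((Ideal.quotientKerAlgEquivOfSurjective hπ).symm (π f)) = _
    rw [h]
    rfl
  -- The coordinates of the universal family at the generators of `A` are the classes of the
  -- variables, so a family determines its classifying map.
  have hυX : ∀ (B : Type u) [CommRing B] [Algebra k B] (φ : R →ₐ[k] B) (i : Fin n) (j : κ),
      (Algebra.TensorProduct.basis B b).repr
        (Algebra.TensorProduct.map φ (AlgHom.id k D) (υ (π (MvPolynomial.X i)))) j =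
      φ (Ideal.Quotient.mk N (MvPolynomial.X (i, j))) := by
    intro B _ _ φ i j
    rw [Algebra.TensorProduct.basis_repr_map, hυ]
    simp only [Ψ, AlgHom.comp_apply, Algebra.TensorProduct.basis_repr_map, Υ,
      MvPolynomial.aeval_X]
    congr 1
    change Ideal.Quotient.mk N _ = _
    congr 1
    rw [map_sum, Finsupp.finsetSum_apply]
    simp [Algebra.TensorProduct.basis_repr_tmul, Finsupp.single_apply]
  refine ⟨R, inferInstance, inferInstance, υ, ?_, inferInstance⟩
  intro B _ _
  constructor
  · intro φ₁ φ₂ h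
    refine Ideal.Quotient.algHom_ext _ (MvPolynomial.algHom_ext fun ⟨i, j⟩ ↦ ?_)
    have h1 := hυX B φ₁ i j
    have h2 := hυX B φ₂ i j
    have h3 := DFunLike.congr_fun h (π (MvPolynomial.X i))
    simp only [AlgHom.comp_apply] at h3
    rw [h3] at h1
    exact h1.symm.trans h2
  · intro α
    let ψ : P →ₐ[k] B := MvPolynomial.aeval fun ij : Fin n × κ ↦
      (Algebra.TensorProduct.basis B b).repr (α (π (MvPolynomial.X ij.1))) ij.2
    have hψ : (Algebra.TensorProduct.map ψ (AlgHom.id k D)).comp Υ = α.comp π := by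
      refine MvPolynomial.algHom_ext fun i ↦ ?_
      simp only [AlgHom.comp_apply, Υ, MvPolynomial.aeval_X, map_sum,
        Algebra.TensorProduct.map_tmul, ψ, AlgHom.id_apply]
      conv_rhs => rw [← (Algebra.TensorProduct.basis B b).sum_repr (α (π (MvPolynomial.X i)))]
      refine Finset.sum_congr rfl fun j _ ↦ ?_
      rw [Algebra.TensorProduct.basis_apply, TensorProduct.smul_tmul', smul_eq_mul, mul_one,
        MvPolynomial.aeval_X]
    have hN : ∀ x ∈ N, ψ x = 0 := by
      intro x hx
      have : N ≤ RingHom.ker ψ := by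
        refine Ideal.span_le.mpr ?_
        rintro _ ⟨f, hf, j, rfl⟩
        change ψ _ = 0
        rw [← Algebra.TensorProduct.basis_repr_map]
        have := DFunLike.congr_fun hψ f
        simp only [AlgHom.comp_apply] at this
        rw [this, hf]
        simp
      exact this hx
    refine ⟨Ideal.Quotient.liftₐ N ψ hN, ?_⟩
    have hsurj := (AlgHom.cancel_right (f := π) hπ (g₁ := (Algebra.TensorProduct.map
      (Ideal.Quotient.liftₐ N ψ hN) (AlgHom.id k D)).comp υ) (g₂ := α))
    refine hsurj.mp ?_
    rw [← hψ]
    refine AlgHom.ext fun f ↦ ?_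
    simp only [AlgHom.comp_apply, hυ, Ψ]
    rw [← AlgHom.comp_apply, ← Algebra.TensorProduct.map_comp]
    rfl

end WeilRestriction

/-! ### Truncation on coordinate rings: smoothness and flatness -/

section Truncation

open scoped TensorProduct

variable {k : Type u} [Field k] {A R R' D D' : Type u} [CommRing A] [CommRing R] [CommRing R']
  [CommRing D] [CommRing D'] [Algebra k A] [Algebra k R] [Algebra k R'] [Algebra k D]
  [Algebra k D']

lemma Algebra.TensorProduct.map_id_comp_map_id {B B' C C' : Type*} [CommRing B] [CommRing B']
    [CommRing C] [CommRing C'] [Algebra k B] [Algebra k B'] [Algebra k C] [Algebra k C']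
    (φ : B →ₐ[k] B') (ρ : C →ₐ[k] C') :
    (Algebra.TensorProduct.map φ (AlgHom.id k C')).comp
        (Algebra.TensorProduct.map (AlgHom.id k B) ρ) =
      (Algebra.TensorProduct.map (AlgHom.id k B') ρ).comp
        (Algebra.TensorProduct.map φ (AlgHom.id k C)) := by
  rw [← Algebra.TensorProduct.map_comp, ← Algebra.TensorProduct.map_comp]
  simp

lemma Algebra.TensorProduct.map_comp_map_id {B B' B'' C : Type*} [CommRing B] [CommRing B']
    [CommRing B''] [CommRing C] [Algebra k B] [Algebra k B'] [Algebra k B''] [Algebra k C]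
    (φ : B →ₐ[k] B') (ψ : B' →ₐ[k] B'') :
    (Algebra.TensorProduct.map ψ (AlgHom.id k C)).comp
        (Algebra.TensorProduct.map φ (AlgHom.id k C)) =
      Algebra.TensorProduct.map (ψ.comp φ) (AlgHom.id k C) := by
  rw [← Algebra.TensorProduct.map_comp]
  simp

/-- Lifting a homomorphism from a formally smooth algebra along `W → U ×_Z V`. -/
lemma Algebra.FormallySmooth.exists_lift_fiberProduct {A W U V Z : Type*} [CommRing A]
    [CommRing W] [CommRing U] [CommRing V] [CommRing Z] [Algebra k A] [Algebra k W] [Algebra k U]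
    [Algebra k V] [Algebra k Z] [Algebra.FormallySmooth k A] (φ : W →ₐ[k] U) (ψ : W →ₐ[k] V)
    (f : U →ₐ[k] Z) (g : V →ₐ[k] Z) (hsq : ∀ w, f (φ w) = g (ψ w))
    (hsurj : ∀ u v, f u = g v → ∃ w, φ w = u ∧ ψ w = v) (hψ : IsNilpotent (RingHom.ker ψ))
    (α : A →ₐ[k] U) (β : A →ₐ[k] V) (hαβ : ∀ a, f (α a) = g (β a)) :
    ∃ ζ : A →ₐ[k] W, φ.comp ζ = α ∧ ψ.comp ζ = β := by
  -- `S` is the fibre product `U ×_Z V`. The kernel of `W → S` lies in `ker ψ`, hence is nilpotent,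
  -- and formal smoothness applies to this surjection.
  let S : Subalgebra k (U × V) :=
    AlgHom.equalizer (f.comp (AlgHom.fst k U V)) (g.comp (AlgHom.snd k U V))
  let Λ : W →ₐ[k] S := (φ.prod ψ).codRestrict S hsq
  have hΛ : Function.Surjective Λ := by
    rintro ⟨⟨u, v⟩, huv⟩
    obtain ⟨w, rfl, rfl⟩ := hsurj u v huv
    exact ⟨w, rfl⟩
  have hnil : IsNilpotent (RingHom.ker (Λ : W →+* S)) := by
    obtain ⟨n, hn⟩ := hψ
    refine ⟨n, ?_⟩
    have hle : RingHom.ker (Λ : W →+* S) ≤ RingHom.ker ψ := fun w hw ↦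
      congrArg (fun z : S ↦ z.1.2) (RingHom.mem_ker.mp hw)
    rw [Ideal.zero_eq_bot, eq_bot_iff]
    exact (Ideal.pow_right_mono hle n).trans hn.le
  let γ : A →ₐ[k] S := (α.prod β).codRestrict S hαβ
  have hζ : ∀ a, Λ (liftOfSurjective γ Λ hΛ hnil a) = γ a :=
    liftOfSurjective_apply γ Λ hΛ hnil
  exact ⟨liftOfSurjective γ Λ hΛ hnil,
    AlgHom.ext fun a ↦ congrArg (fun z : S ↦ z.1.1) (hζ a),
    AlgHom.ext fun a ↦ congrArg (fun z : S ↦ z.1.2) (hζ a)⟩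

/-- Lifting a compatible pair of homomorphisms from a formally smooth algebra. -/
lemma Algebra.FormallySmooth.exists_lift_tensorProduct [Algebra.FormallySmooth k A] {B : Type u}
    [CommRing B] [Algebra k B] (I : Ideal B) (hI : I ^ 2 = ⊥) (ρ : D' →ₐ[k] D)
    (hρ : Function.Surjective ρ) (α : A →ₐ[k] B ⊗[k] D) (β : A →ₐ[k] (B ⧸ I) ⊗[k] D')
    (hαβ : (Algebra.TensorProduct.map (Ideal.Quotient.mkₐ k I) (AlgHom.id k D)).comp α =
      (Algebra.TensorProduct.map (AlgHom.id k (B ⧸ I)) ρ).comp β) :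
    ∃ ζ : A →ₐ[k] B ⊗[k] D', (Algebra.TensorProduct.map (AlgHom.id k B) ρ).comp ζ = α ∧
      (Algebra.TensorProduct.map (Ideal.Quotient.mkₐ k I) (AlgHom.id k D')).comp ζ = β := by
  have hsq := DFunLike.congr_fun
    (Algebra.TensorProduct.map_id_comp_map_id (Ideal.Quotient.mkₐ k I) ρ)
  refine Algebra.FormallySmooth.exists_lift_fiberProduct _ _
    (Algebra.TensorProduct.map (Ideal.Quotient.mkₐ k I) (AlgHom.id k D))
    (Algebra.TensorProduct.map (AlgHom.id k (B ⧸ I)) ρ) hsq ?_ ?_ α β (DFunLike.congr_fun hαβ)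
  · intro x y hxy
    obtain ⟨w, rfl⟩ := Algebra.TensorProduct.map_surjective (AlgHom.id k B) ρ
      Function.surjective_id hρ x
    have hsurj := Algebra.TensorProduct.map_surjective (Ideal.Quotient.mkₐ k I) (AlgHom.id k D')
      Ideal.Quotient.mk_surjective Function.surjective_id
    -- After lifting `x` to `w`, the error in the second component lies in the ideal generated by
    -- `ker ρ`; it lifts to an element `v` of the corresponding ideal of `B ⊗ D'`, which does not
    -- disturb the first component.
    have h1 : y - Algebra.TensorProduct.map (Ideal.Quotient.mkₐ k I) (AlgHom.id k D') w ∈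
        RingHom.ker (Algebra.TensorProduct.map (AlgHom.id k (B ⧸ I)) ρ) := by
      rw [RingHom.mem_ker, map_sub, ← hxy, sub_eq_zero]
      exact hsq w
    rw [Algebra.TensorProduct.lTensor_ker ρ hρ] at h1
    have h2 : (RingHom.ker ρ).map (Algebra.TensorProduct.includeRight : D' →ₐ[k] (B ⧸ I) ⊗[k] D') =
        ((RingHom.ker ρ).map (Algebra.TensorProduct.includeRight : D' →ₐ[k] B ⊗[k] D')).map
          (Algebra.TensorProduct.map (Ideal.Quotient.mkₐ k I) (AlgHom.id k D')) := by
      rw [Ideal.map_mapₐ, Algebra.TensorProduct.map_comp_includeRight, AlgHom.comp_id]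
    rw [h2, Ideal.mem_map_iff_of_surjective _ hsurj,
      ← Algebra.TensorProduct.lTensor_ker ρ hρ] at h1
    obtain ⟨v, hv, hv'⟩ := h1
    refine ⟨w + v, ?_, ?_⟩
    · rw [map_add, RingHom.mem_ker.mp hv, add_zero]
    · rw [map_add, hv', add_sub_cancel]
  · refine ⟨2, ?_⟩
    rw [Algebra.TensorProduct.rTensor_ker _ Ideal.Quotient.mk_surjective, ← Ideal.map_pow]
    have : RingHom.ker (Ideal.Quotient.mkₐ k I) = I := Ideal.mk_ker
    rw [this, hI, Ideal.map_bot]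
    rfl

/-- If `A` is formally smooth, restricting families along a surjection `ρ : D' → D` is a formally
smooth operation. -/
theorem AlgHom.IsUniversalFamily.formallySmooth [Algebra.FormallySmooth k A] [Algebra R R']
    [IsScalarTower k R R'] {υ : A →ₐ[k] R ⊗[k] D} {υ' : A →ₐ[k] R' ⊗[k] D'}
    (hυ : υ.IsUniversalFamily) (hυ' : υ'.IsUniversalFamily) (ρ : D' →ₐ[k] D)
    (hρ : Function.Surjective ρ)
    (h : (Algebra.TensorProduct.map (IsScalarTower.toAlgHom k R R') (AlgHom.id k D)).comp υ =
      (Algebra.TensorProduct.map (AlgHom.id k R') ρ).comp υ') :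
    Algebra.FormallySmooth R R' := by
  refine .of_comp_surjective fun B _ _ I hI f ↦ ?_
  let : Algebra k B := ((algebraMap R B).comp (algebraMap k R)).toAlgebra
  have : IsScalarTower k R B := .of_algebraMap_eq' rfl
  let mk : B →ₐ[k] B ⧸ I := Ideal.Quotient.mkₐ k I
  let g : R →ₐ[k] B := IsScalarTower.toAlgHom k R B
  let r : R →ₐ[k] R' := IsScalarTower.toAlgHom k R R'
  let f' : R' →ₐ[k] B ⧸ I :=
    { f.toRingHom with
      commutes' := fun c ↦ by
        have h1 : algebraMap k R' c = algebraMap R R' (algebraMap k R c) :=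
          IsScalarTower.algebraMap_apply k R R' c
        change f (algebraMap k R' c) = _
        rw [h1, f.commutes]
        rfl }
  have hfr : f'.comp r = mk.comp g := AlgHom.ext fun x ↦ f.commutes x
  let α : A →ₐ[k] B ⊗[k] D := (Algebra.TensorProduct.map g (AlgHom.id k D)).comp υ
  let β : A →ₐ[k] (B ⧸ I) ⊗[k] D' := (Algebra.TensorProduct.map f' (AlgHom.id k D')).comp υ'
  have hαβ : (Algebra.TensorProduct.map mk (AlgHom.id k D)).comp α =
      (Algebra.TensorProduct.map (AlgHom.id k (B ⧸ I)) ρ).comp β := by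
    simp only [α, β]
    rw [← AlgHom.comp_assoc, Algebra.TensorProduct.map_comp_map_id, ← hfr, ← AlgHom.comp_assoc,
      ← Algebra.TensorProduct.map_id_comp_map_id, AlgHom.comp_assoc, ← h, ← AlgHom.comp_assoc,
      Algebra.TensorProduct.map_comp_map_id]
  obtain ⟨ζ, hζα, hζβ⟩ :=
    Algebra.FormallySmooth.exists_lift_tensorProduct I hI ρ hρ α β hαβ
  -- `F` classifies the lifted family; uniqueness for `υ` makes it `R`-linear, and uniqueness for
  -- `υ'` makes it lift `f`.
  obtain ⟨F, hF⟩ := (hυ' B).2 ζ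
  have hF : (Algebra.TensorProduct.map F (AlgHom.id k D')).comp υ' = ζ := hF
  have hFr : F.comp r = g := by
    refine (hυ B).1 ?_
    change (Algebra.TensorProduct.map (F.comp r) (AlgHom.id k D)).comp υ = α
    rw [← Algebra.TensorProduct.map_comp_map_id, AlgHom.comp_assoc, h, ← AlgHom.comp_assoc,
      Algebra.TensorProduct.map_id_comp_map_id, AlgHom.comp_assoc, hF, hζα]
  have hmF : mk.comp F = f' := by
    refine (hυ' (B ⧸ I)).1 ?_
    change (Algebra.TensorProduct.map (mk.comp F) (AlgHom.id k D')).comp υ' = β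
    rw [← Algebra.TensorProduct.map_comp_map_id, AlgHom.comp_assoc, hF, hζβ]
  refine ⟨{ F.toRingHom with commutes' := fun x ↦ DFunLike.congr_fun hFr x }, ?_⟩
  exact AlgHom.ext fun x ↦ DFunLike.congr_fun hmF x

/-- If restriction of families along `ρ : D' → D` is flat, and there is a functional on `D'`
detecting some `τ ∈ ker ρ` and vanishing on `1` and on `(ker ρ)²`, then `Ω[A⁄k]` is flat. -/
theorem AlgHom.IsUniversalFamily.flat_kaehlerDifferential [Algebra R R']
    [IsScalarTower k R R'] [Module.Flat R R'] {υ : A →ₐ[k] R ⊗[k] D} {υ' : A →ₐ[k] R' ⊗[k] D'}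
    (hυ : υ.IsUniversalFamily) (hυ' : υ'.IsUniversalFamily) (ρ : D' →ₐ[k] D)
    (hρ : Function.Surjective ρ)
    (h : (Algebra.TensorProduct.map (IsScalarTower.toAlgHom k R R') (AlgHom.id k D)).comp υ =
      (Algebra.TensorProduct.map (AlgHom.id k R') ρ).comp υ')
    (c : D' →ₗ[k] k) (hc1 : c 1 = 0) (hc2 : ∀ x y, ρ x = 0 → ρ y = 0 → c (x * y) = 0)
    (τ : D') (hτ : ρ τ = 0) (hcτ : c τ = 1) :
    Module.Flat A Ω[A⁄k] := by
  -- `s` classifies the constant family.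
  obtain ⟨s, hs⟩ := (hυ A).2 Algebra.TensorProduct.includeLeft
  have hs : (Algebra.TensorProduct.map s (AlgHom.id k D)).comp υ =
    Algebra.TensorProduct.includeLeft := hs
  let r : R →ₐ[k] R' := IsScalarTower.toAlgHom k R R'
  let : Algebra R A := s.toRingHom.toAlgebra
  have : IsScalarTower k R A := .of_algebraMap_eq fun x ↦ (s.commutes x).symm
  let G := A ⊗[R] R'
  let ι : R' →ₐ[k] G := (Algebra.TensorProduct.includeRight : R' →ₐ[R] G).restrictScalars k
  let j : A →ₐ[k] G := IsScalarTower.toAlgHom k A G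
  have hjs : j.comp s = ι.comp r := AlgHom.ext fun x ↦ by
    have h1 : ι (r x) = algebraMap R G x :=
      (Algebra.TensorProduct.includeRight : R' →ₐ[R] G).commutes x
    have h2 : j (s x) = algebraMap R G x := (IsScalarTower.algebraMap_apply R A G x).symm
    exact h2.trans h1.symm
  obtain ⟨ζ, hζ⟩ : ∃ ζ : A →ₐ[k] G ⊗[k] D',
      ζ = (Algebra.TensorProduct.map ι (AlgHom.id k D')).comp υ' := ⟨_, rfl⟩
  let ρG := Algebra.TensorProduct.map (AlgHom.id k G) ρ
  have hρζ : ∀ a, ρG (ζ a) = j a ⊗ₜ 1 := by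
    have : ρG.comp ζ = (Algebra.TensorProduct.map j (AlgHom.id k D)).comp
        Algebra.TensorProduct.includeLeft := by
      rw [← hs, ← AlgHom.comp_assoc, Algebra.TensorProduct.map_comp_map_id, hjs,
        ← Algebra.TensorProduct.map_comp_map_id, AlgHom.comp_assoc, h]
      rw [hζ, ← AlgHom.comp_assoc, ← Algebra.TensorProduct.map_id_comp_map_id, AlgHom.comp_assoc]
    intro a
    simpa using DFunLike.congr_fun this a
  let cG : G ⊗[k] D' →ₗ[G] G :=
    (TensorProduct.AlgebraTensorModule.rid k G G).toLinearMap ∘ₗ c.baseChange G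
  have hcG : ∀ (x : G) (d : D'), cG (x ⊗ₜ d) = c d • x := fun x d ↦ by simp [cG]
  have hker : ∀ z, ρG z = 0 → z ∈ LinearMap.range
      (LinearMap.lTensor G (LinearMap.ker ρ.toLinearMap).subtype) := fun z hz ↦
    (lTensor_exact G (LinearMap.exact_subtype_ker_map ρ.toLinearMap) hρ z).mp hz
  have hcG2 : ∀ z w, ρG z = 0 → ρG w = 0 → cG (z * w) = 0 := by
    intro z w hz hw
    obtain ⟨z, rfl⟩ := hker z hz
    obtain ⟨w, rfl⟩ := hker w hw
    clear hz hw
    induction z with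
    | zero => simp
    | add z₁ z₂ h₁ h₂ => rw [map_add, add_mul, map_add, h₁, h₂, add_zero]
    | tmul x d =>
      induction w with
      | zero => simp
      | add w₁ w₂ h₁ h₂ => rw [map_add, mul_add, map_add, h₁, h₂, add_zero]
      | tmul x' d' =>
        simp only [LinearMap.lTensor_tmul, Submodule.subtype_apply,
          Algebra.TensorProduct.tmul_mul_tmul, hcG]
        rw [hc2 _ _ d.2 d'.2, zero_smul]
  let δ : Derivation k A G := Derivation.mk' ((cG.restrictScalars k) ∘ₗ ζ.toLinearMap) fun a b ↦ by
    simp only [LinearMap.comp_apply, LinearMap.restrictScalars_apply, AlgHom.toLinearMap_apply,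
      map_mul]
    -- The first summand is a product of two elements of the kernel of `ρG`, so `cG` kills it; the
    -- last is killed because `c 1 = 0`. What remains is the Leibniz rule.
    have e : ζ a * ζ b = (ζ a - j a ⊗ₜ 1) * (ζ b - j b ⊗ₜ 1) + j a • ζ b + j b • ζ a
        - (j a * j b) ⊗ₜ 1 := by
      have : ∀ (x : G) (z : G ⊗[k] D'), x • z = (x ⊗ₜ 1) * z := fun x z ↦ by
        rw [← mul_one x, ← smul_eq_mul, ← TensorProduct.smul_tmul', smul_mul_assoc,
          ← Algebra.TensorProduct.one_def, one_mul, smul_eq_mul, mul_one]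
      rw [this, this, show (j a * j b) ⊗ₜ[k] (1 : D') = (j a ⊗ₜ 1) * (j b ⊗ₜ 1) by simp]
      ring
    rw [e, map_sub, map_add, map_add, hcG2 _ _ (by rw [map_sub, hρζ]; simp [ρG])
      (by rw [map_sub, hρζ]; simp [ρG]), hcG, hc1, map_smul, map_smul]
    simp only [zero_add, zero_smul, sub_zero, j, IsScalarTower.coe_toAlgHom', algebraMap_smul]
  let : Module Aᵐᵒᵖ Ω[A⁄k] := Module.compHom _ ((RingHom.id A).fromOpposite mul_comm)
  have : IsCentralScalar A Ω[A⁄k] := ⟨fun _ _ ↦ rfl⟩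
  let T := TrivSqZeroExt A Ω[A⁄k]
  let dinr : A →ₗ[k] T := (TrivSqZeroExt.inrHom A Ω[A⁄k]).restrictScalars k ∘ₗ
    (KaehlerDifferential.D k A).toLinearMap
  let inl : A →ₐ[k] T := TrivSqZeroExt.inlAlgHom k A Ω[A⁄k]
  -- The family `a ↦ a + τ da`. It is multiplicative whatever `τ²` is, because products of
  -- differentials vanish in `T`.
  let βl : A →ₗ[k] T ⊗[k] D' :=
    (Algebra.TensorProduct.includeLeft : T →ₐ[k] T ⊗[k] D').toLinearMap ∘ₗ inl.toLinearMap +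
      (TensorProduct.mk k T D').flip τ ∘ₗ dinr
  have hβl : ∀ a, βl a = inl a ⊗ₜ 1 + dinr a ⊗ₜ τ := fun a ↦ rfl
  have hd1 : dinr 1 = 0 := by simp [dinr]
  have hdd : ∀ a b, dinr a * dinr b = 0 := fun a b ↦ TrivSqZeroExt.inr_mul_inr _ _ _
  have hdm : ∀ a b, dinr (a * b) = inl a * dinr b + dinr a * inl b := fun a b ↦ by
    change TrivSqZeroExt.inr (KaehlerDifferential.D k A (a * b)) = TrivSqZeroExt.inl a *
      TrivSqZeroExt.inr (KaehlerDifferential.D k A b) +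
        TrivSqZeroExt.inr (KaehlerDifferential.D k A a) * TrivSqZeroExt.inl b
    rw [Derivation.leibniz, TrivSqZeroExt.inl_mul_inr, TrivSqZeroExt.inr_mul_inl,
      op_smul_eq_smul, TrivSqZeroExt.inr_add]
  let β : A →ₐ[k] T ⊗[k] D' := AlgHom.ofLinearMap βl
    (by rw [hβl, hd1, map_one, TensorProduct.zero_tmul, add_zero]; rfl)
    (fun a b ↦ by
      rw [hβl, hβl, hβl, hdm, add_mul, mul_add, mul_add]
      simp only [Algebra.TensorProduct.tmul_mul_tmul, hdd, TensorProduct.zero_tmul, mul_one,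
        one_mul, map_mul, TensorProduct.add_tmul, add_zero]
      abel)
  have hβ : ∀ a, β a = inl a ⊗ₜ 1 + dinr a ⊗ₜ τ := fun a ↦ rfl
  obtain ⟨θ, hθ⟩ := (hυ' T).2 β
  have hθ : (Algebra.TensorProduct.map θ (AlgHom.id k D')).comp υ' = β := hθ
  -- Since `ρ τ = 0`, the family `β` restricts to the constant one along `ρ`; hence `θ` factors
  -- through `G`.
  have hθr : θ.comp r = inl.comp s := by
    refine (hυ T).1 ?_
    change (Algebra.TensorProduct.map (θ.comp r) (AlgHom.id k D)).comp υ =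
      (Algebra.TensorProduct.map (inl.comp s) (AlgHom.id k D)).comp υ
    rw [← Algebra.TensorProduct.map_comp_map_id, AlgHom.comp_assoc, h, ← AlgHom.comp_assoc,
      Algebra.TensorProduct.map_id_comp_map_id, AlgHom.comp_assoc, hθ,
      ← Algebra.TensorProduct.map_comp_map_id, AlgHom.comp_assoc, hs]
    refine AlgHom.ext fun a ↦ ?_
    simp [hβ, hτ]
  let θR : R' →ₐ[R] T := { θ.toRingHom with commutes' := fun x ↦ DFunLike.congr_fun hθr x }
  let Θ : G →ₐ[A] T := Algebra.TensorProduct.lift (Algebra.ofId A T) θR fun _ _ ↦ .all _ _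
  have hΘι : (Θ.restrictScalars k).comp ι = θ := AlgHom.ext fun x ↦ by
    change Θ (1 ⊗ₜ x) = θ x
    rw [Algebra.TensorProduct.lift_tmul, map_one, one_mul]
    rfl
  let cT : T ⊗[k] D' →ₗ[T] T :=
    (TensorProduct.AlgebraTensorModule.rid k T T).toLinearMap ∘ₗ c.baseChange T
  have hcT : ∀ (x : T) (d : D'), cT (x ⊗ₜ d) = c d • x := fun x d ↦ by simp [cT]
  have hΘc : ∀ z, Θ (cG z) =
      cT (Algebra.TensorProduct.map (Θ.restrictScalars k) (AlgHom.id k D') z) := by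
    intro z
    induction z with
    | zero => simp
    | add x y hx hy => simp only [map_add, hx, hy]
    | tmul x d =>
      rw [Algebra.TensorProduct.map_tmul, hcG, hcT]
      exact map_smul (Θ.restrictScalars k) _ _
  have hΘζ : (Algebra.TensorProduct.map (Θ.restrictScalars k) (AlgHom.id k D')).comp ζ = β := by
    rw [hζ, ← AlgHom.comp_assoc, Algebra.TensorProduct.map_comp_map_id, hΘι, hθ]
  let p : G →ₗ[A] Ω[A⁄k] := TrivSqZeroExt.sndHom A Ω[A⁄k] ∘ₗ Θ.toLinearMap
  refine Module.Flat.of_retract (M := G) δ.liftKaehlerDifferential p ?_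
  apply Derivation.liftKaehlerDifferential_unique
  ext a
  change p (δ.liftKaehlerDifferential (KaehlerDifferential.D k A a)) = KaehlerDifferential.D k A a
  rw [Derivation.liftKaehlerDifferential_comp_D]
  change (Θ (cG (ζ a))).snd = _
  rw [hΘc]
  have := DFunLike.congr_fun hΘζ a
  simp only [AlgHom.comp_apply] at this
  rw [this, hβ, map_add, hcT, hcT, hc1, hcτ, zero_smul, zero_add, one_smul]
  rfl

end Truncation

/-! ### Universal families of schemes and their restriction to opens -/

section UniversalFamily

open Limits CartesianMonoidalCategory

variable {S : Scheme.{u}} {D : Over S}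

/-- A family `u : Z × D ⟶ X` is universal if every family `Y × D ⟶ X` is the pullback of `u` along
a unique morphism `Y ⟶ Z`. -/
def IsUniversalFamily {X Z : Over S} (u : Z ⊗ D ⟶ X) : Prop :=
  ∀ Y : Over S, Function.Bijective fun g : Y ⟶ Z ↦ g ▷ D ≫ u

/-- The restriction of an object over `S` along a morphism to its underlying scheme. -/
abbrev overRestrict (Y : Over S) {V : Scheme.{u}} (f : V ⟶ Y.left) : Over S := Over.mk (f ≫ Y.hom)

/-- The canonical morphism from a restriction. -/
abbrev overRestrictHom (Y : Over S) {V : Scheme.{u}} (f : V ⟶ Y.left) : overRestrict Y f ⟶ Y :=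
  Over.homMk f

lemma Over.hom_ext_openCover {Y X : Over S} (𝒰 : Y.left.OpenCover) {f g : Y ⟶ X}
    (h : ∀ i, overRestrictHom Y (𝒰.f i) ≫ f = overRestrictHom Y (𝒰.f i) ≫ g) : f = g := by
  ext1
  exact 𝒰.hom_ext _ _ fun i ↦ congrArg Over.Hom.left (h i)

/-- The restriction of `Y ⊗ D` to the preimage of `V ⟶ Y` maps to `V ⊗ D`. -/
noncomputable def overRestrictTensor (Y D : Over S) {V : Scheme.{u}} (f : V ⟶ Y.left) :
    overRestrict (Y ⊗ D) (pullback.fst (fst Y D).left f) ⟶ overRestrict Y f ⊗ D :=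
  lift (Over.homMk (pullback.snd _ _) (by
      change pullback.snd _ _ ≫ f ≫ Y.hom = pullback.fst _ _ ≫ (Y ⊗ D).hom
      rw [← pullback.condition_assoc, Over.w]))
    (overRestrictHom (Y ⊗ D) _ ≫ snd Y D)

lemma overRestrictTensor_whiskerRight (Y D : Over S) {V : Scheme.{u}} (f : V ⟶ Y.left) :
    overRestrictTensor Y D f ≫ overRestrictHom Y f ▷ D =
      overRestrictHom (Y ⊗ D) (pullback.fst (fst Y D).left f) := by
  apply CartesianMonoidalCategory.hom_ext
  · rw [Category.assoc, whiskerRight_fst, overRestrictTensor, lift_fst_assoc]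
    ext1
    exact pullback.condition.symm
  · rw [Category.assoc, whiskerRight_snd, overRestrictTensor, lift_snd]

lemma Over.tensor_hom_ext_openCover {Y X : Over S} (𝒰 : Y.left.OpenCover) {f g : Y ⊗ D ⟶ X}
    (h : ∀ i, overRestrictHom Y (𝒰.f i) ▷ D ≫ f = overRestrictHom Y (𝒰.f i) ▷ D ≫ g) : f = g := by
  refine Over.hom_ext_openCover (𝒰.pullback₁ (fst Y D).left) fun i ↦ ?_
  change overRestrictHom (Y ⊗ D) (pullback.fst (fst Y D).left (𝒰.f i)) ≫ f =
    overRestrictHom (Y ⊗ D) (pullback.fst (fst Y D).left (𝒰.f i)) ≫ g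
  rw [← overRestrictTensor_whiskerRight, Category.assoc, Category.assoc]
  exact congrArg (overRestrictTensor Y D (𝒰.f i) ≫ ·) (h i)

/-- If a family has at most one classifying morphism, classifying morphisms can be found locally. -/
lemma exists_classifying_of_openCover {X Z : Over S} {u : Z ⊗ D ⟶ X}
    (hu : ∀ (Y : Over S) (g h : Y ⟶ Z), g ▷ D ≫ u = h ▷ D ≫ u → g = h) {Y : Over S}
    (f : Y ⊗ D ⟶ X) (𝒰 : Y.left.OpenCover)
    (h : ∀ i, ∃ g : overRestrict Y (𝒰.f i) ⟶ Z, g ▷ D ≫ u = overRestrictHom Y (𝒰.f i) ▷ D ≫ f) :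
    ∃ g : Y ⟶ Z, g ▷ D ≫ u = f := by
  choose g hg using h
  have hcomp : ∀ i j, pullback.fst (𝒰.f i) (𝒰.f j) ≫ (g i).left =
      pullback.snd (𝒰.f i) (𝒰.f j) ≫ (g j).left := by
    intro i j
    let W : Over S := Over.mk (pullback.fst (𝒰.f i) (𝒰.f j) ≫ 𝒰.f i ≫ Y.hom)
    let a : W ⟶ overRestrict Y (𝒰.f i) := Over.homMk (pullback.fst _ _)
    let b : W ⟶ overRestrict Y (𝒰.f j) := Over.homMk (pullback.snd _ _) (by
      change pullback.snd _ _ ≫ 𝒰.f j ≫ Y.hom = pullback.fst _ _ ≫ 𝒰.f i ≫ Y.hom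
      rw [pullback.condition_assoc])
    have hab : a ≫ overRestrictHom Y (𝒰.f i) = b ≫ overRestrictHom Y (𝒰.f j) := by
      ext1; exact pullback.condition
    have : a ≫ g i = b ≫ g j := by
      apply hu
      simp only [comp_whiskerRight, Category.assoc, hg]
      rw [← comp_whiskerRight_assoc, hab, comp_whiskerRight_assoc]
    exact congrArg Over.Hom.left this
  obtain ⟨G₀, hG₀⟩ : ∃ G₀ : Y.left ⟶ Z.left, ∀ i, 𝒰.f i ≫ G₀ = (g i).left :=
    ⟨𝒰.glueMorphisms (fun i ↦ (g i).left) hcomp, fun i ↦ 𝒰.ι_glueMorphisms _ _ i⟩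
  have hw : G₀ ≫ Z.hom = Y.hom := by
    refine 𝒰.hom_ext _ _ fun i ↦ ?_
    rw [reassoc_of% hG₀, Over.w]
    rfl
  obtain ⟨G, hG⟩ : ∃ G : Y ⟶ Z, ∀ i, overRestrictHom Y (𝒰.f i) ≫ G = g i :=
    ⟨Over.homMk G₀ hw, fun i ↦ Over.OverMorphism.ext (hG₀ i)⟩
  refine ⟨G, Over.tensor_hom_ext_openCover 𝒰 fun i ↦ ?_⟩
  rw [← comp_whiskerRight_assoc, hG, hg]

/-- Universality may be tested on affine schemes. -/
theorem IsUniversalFamily.of_isAffine {X Z : Over S} {u : Z ⊗ D ⟶ X}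
    (h : ∀ Y : Over S, IsAffine Y.left → Function.Bijective fun g : Y ⟶ Z ↦ g ▷ D ≫ u) :
    IsUniversalFamily u := by
  have hinj : ∀ (Y : Over S) (g h : Y ⟶ Z), g ▷ D ≫ u = h ▷ D ≫ u → g = h := by
    intro Y g g' hgg
    refine Over.hom_ext_openCover Y.left.affineCover fun i ↦ ?_
    have : IsAffine (overRestrict Y (Y.left.affineCover.f i)).left :=
      inferInstanceAs (IsAffine (Y.left.affineCover.X i))
    refine (h _ this).1 ?_
    simp only [comp_whiskerRight, Category.assoc, hgg]
  refine fun Y ↦ ⟨fun g g' ↦ hinj Y g g', fun f ↦ ?_⟩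
  refine exists_classifying_of_openCover hinj f Y.left.affineCover fun i ↦ ?_
  have : IsAffine (overRestrict Y (Y.left.affineCover.f i)).left :=
    inferInstanceAs (IsAffine (Y.left.affineCover.X i))
  exact (h _ this).2 _

lemma IsUniversalFamily.comp_iso {X X' Z : Over S} {u : Z ⊗ D ⟶ X} (hu : IsUniversalFamily u)
    (e : X ≅ X') : IsUniversalFamily (u ≫ e.hom) := by
  intro Y
  have : (fun g : Y ⟶ Z ↦ g ▷ D ≫ u ≫ e.hom) =
      e.homToEquiv ∘ fun g : Y ⟶ Z ↦ g ▷ D ≫ u := by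
    ext g; simp
  rw [this]
  exact e.homToEquiv.bijective.comp (hu Y)

/-- Two universal families are related by a unique isomorphism. -/
lemma IsUniversalFamily.exists_iso {X Z Z' : Over S} {u : Z ⊗ D ⟶ X} {u' : Z' ⊗ D ⟶ X}
    (hu : IsUniversalFamily u) (hu' : IsUniversalFamily u') :
    ∃ e : Z ≅ Z', e.hom ▷ D ≫ u' = u := by
  obtain ⟨a, ha⟩ := (hu' Z).2 u
  obtain ⟨b, hb⟩ := (hu Z').2 u'
  dsimp only at ha hb
  refine ⟨⟨a, b, (hu Z).1 ?_, (hu' Z').1 ?_⟩, ha⟩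
  · simp [hb, ha]
  · simp [hb, ha]

section Point

variable (σ : S ⟶ D.left) (hσ : σ ≫ D.hom = 𝟙 S)

/-- The section of `Y × D ⟶ Y` given by a rational point of `D`. -/
noncomputable def constSection (Y : Over S) : Y ⟶ Y ⊗ D :=
  lift (𝟙 Y) (Over.homMk (Y.hom ≫ σ) (by rw [Category.assoc, hσ, Category.comp_id]))

lemma constSection_naturality {Y Z : Over S} (g : Y ⟶ Z) :
    g ≫ constSection σ hσ Z = constSection σ hσ Y ≫ g ▷ D := by
  apply CartesianMonoidalCategory.hom_ext
  · simp [constSection]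
  · simp only [constSection, comp_lift, lift_whiskerRight, lift_snd]
    ext1
    simp

lemma constSection_naturality_assoc {Y Z X : Over S} (g : Y ⟶ Z) (f : Z ⊗ D ⟶ X) :
    g ≫ constSection σ hσ Z ≫ f = constSection σ hσ Y ≫ g ▷ D ≫ f := by
  rw [← Category.assoc, constSection_naturality, Category.assoc]

/-- The section is a base change of `σ`. When `D` is a single point, this lets the image of a family
be read off from its base. -/
lemma constSection_surjective [Surjective σ] (Y : Over S) :
    Surjective (constSection σ hσ Y).left := by
  have h1 : (constSection σ hσ Y).left ≫ pullback.fst Y.hom D.hom = 𝟙 _ := by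
    exact congrArg Over.Hom.left (lift_fst (𝟙 Y) _)
  have h2 : (constSection σ hσ Y).left ≫ pullback.snd Y.hom D.hom = Y.hom ≫ σ := by
    exact congrArg Over.Hom.left (lift_snd (𝟙 Y) _)
  have hpb : IsPullback (constSection σ hσ Y).left Y.hom (pullback.snd Y.hom D.hom) σ := by
    refine IsPullback.of_right (h₁₂ := pullback.fst Y.hom D.hom) (h₂₂ := D.hom) (v₁₃ := Y.hom)
      ?_ h2 (IsPullback.of_hasPullback Y.hom D.hom)
    rw [h1, hσ]
    exact IsPullback.of_horiz_isIso ⟨by simp⟩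
  exact MorphismProperty.of_isPullback (P := @Surjective) hpb.flip ‹_›

/-- The projection from the base of a family to its target: a family is sent to its value at the
given point of `D`. -/
noncomputable abbrev familyBase {X Z : Over S} (u : Z ⊗ D ⟶ X) : Z ⟶ X := constSection σ hσ Z ≫ u

/-- If `D` has only one point, a family whose base lands in an open subscheme lands in it. -/
lemma exists_lift_of_isOpenImmersion [Surjective σ] {Y U X : Over S} (f : Y ⊗ D ⟶ X) (j : U ⟶ X)
    [IsOpenImmersion j.left] (a : Y ⟶ U) (ha : a ≫ j = constSection σ hσ Y ≫ f) :
    ∃ f' : Y ⊗ D ⟶ U, f' ≫ j = f := by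
  have hr : Set.range f.left ⊆ Set.range j.left := by
    rintro _ ⟨x, rfl⟩
    obtain ⟨y, rfl⟩ := (constSection_surjective σ hσ Y).surj x
    refine ⟨a.left y, ?_⟩
    have := congrArg Over.Hom.left ha
    rw [Over.comp_left, Over.comp_left] at this
    rw [← Scheme.Hom.comp_apply, ← Scheme.Hom.comp_apply, this]
  have h1 := IsOpenImmersion.lift_fac j.left f.left hr
  refine ⟨Over.homMk (IsOpenImmersion.lift j.left f.left hr) ?_, ?_⟩
  · rw [← Over.w j, reassoc_of% h1, Over.w]
  · ext1; exact h1

instance overMono_of_isOpenImmersion {U X : Over S} (j : U ⟶ X) [IsOpenImmersion j.left] :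
    Mono j :=
  Over.mono_of_mono_left j

/-- The restriction of a universal family for `X` to the preimage of an open subscheme `U` is a
universal family for `U`. -/
theorem IsUniversalFamily.restrict [Surjective σ] {X Z U W : Over S} {u : Z ⊗ D ⟶ X}
    (hu : IsUniversalFamily u) (j : U ⟶ X) [IsOpenImmersion j.left] (i : W ⟶ Z) (p : W ⟶ U)
    (hpb : IsPullback i.left p.left (familyBase σ hσ u).left j.left) :
    ∃ w : W ⊗ D ⟶ U, w ≫ j = i ▷ D ≫ u ∧ IsUniversalFamily w ∧ familyBase σ hσ w = p := by
  have hw : i ≫ familyBase σ hσ u = p ≫ j := by ext1; exact hpb.w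
  have : IsOpenImmersion i.left := MorphismProperty.of_isPullback hpb.flip ‹_›
  obtain ⟨w, hwj⟩ := exists_lift_of_isOpenImmersion σ hσ (i ▷ D ≫ u) j p (by
    rw [← hw, constSection_naturality_assoc])
  refine ⟨w, hwj, fun Y ↦ ⟨fun g h hgh ↦ ?_, fun f ↦ ?_⟩, ?_⟩
  · rw [← cancel_mono i]
    refine (hu Y).1 ?_
    dsimp only at hgh ⊢
    rw [comp_whiskerRight_assoc, comp_whiskerRight_assoc, ← hwj, reassoc_of% hgh]
  · obtain ⟨g, hg⟩ := (hu Y).2 (f ≫ j)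
    dsimp only at hg
    have h1 : g ≫ familyBase σ hσ u = (constSection σ hσ Y ≫ f) ≫ j := by
      rw [constSection_naturality_assoc, hg, Category.assoc]
    let h : Y ⟶ W := Over.homMk (hpb.lift g.left (constSection σ hσ Y ≫ f).left
      (congrArg Over.Hom.left h1)) (by rw [← Over.w i, hpb.lift_fst_assoc, Over.w])
    have hi : h ≫ i = g := by ext1; exact hpb.lift_fst _ _ _
    refine ⟨h, ?_⟩
    dsimp only
    rw [← cancel_mono j, Category.assoc, hwj, ← comp_whiskerRight_assoc, hi, hg]
  · rw [← cancel_mono j, ← hw, Category.assoc, hwj, constSection_naturality_assoc]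

end Point

end UniversalFamily

/-! ### Gluing universal families -/

section UniversalFamilyGluing

open Limits CartesianMonoidalCategory

variable {S : Scheme.{u}} {D : Over S} (σ : S ⟶ D.left) (hσ : σ ≫ D.hom = 𝟙 S)

/-- A morphism of universal families over an open immersion `j : U ⟶ X` identifies the parameter
space of the former with the preimage of `U`. -/
theorem IsUniversalFamily.isPullback [Surjective σ] {X Z U W : Over S} {u : Z ⊗ D ⟶ X}
    (hu : IsUniversalFamily u) {w : W ⊗ D ⟶ U} (hw : IsUniversalFamily w) (j : U ⟶ X)
    [IsOpenImmersion j.left] (i : W ⟶ Z) (hi : i ▷ D ≫ u = w ≫ j) :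
    IsPullback i.left (familyBase σ hσ w).left (familyBase σ hσ u).left j.left := by
  -- The preimage `P` of `U` also carries a universal family for `U`, so it is uniquely isomorphic
  -- to `W`.
  let P : Over S := Over.mk (pullback.fst (familyBase σ hσ u).left j.left ≫ Z.hom)
  let i' : P ⟶ Z := Over.homMk (pullback.fst (familyBase σ hσ u).left j.left)
  let p : P ⟶ U := Over.homMk (pullback.snd (familyBase σ hσ u).left j.left) (by
    change _ = pullback.fst (familyBase σ hσ u).left j.left ≫ Z.hom
    rw [← Over.w j, ← pullback.condition_assoc, Over.w])
  have hpb : IsPullback i'.left p.left (familyBase σ hσ u).left j.left :=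
    IsPullback.of_hasPullback _ _
  obtain ⟨w', hw'j, hw', hp⟩ := hu.restrict σ hσ j i' p hpb
  obtain ⟨e, he⟩ := hw.exists_iso hw'
  have h1 : e.hom ≫ i' = i := by
    refine (hu W).1 ?_
    dsimp only
    rw [hi, ← he, comp_whiskerRight_assoc, ← hw'j, Category.assoc]
  have h2 : e.hom ≫ p = familyBase σ hσ w := by
    rw [← hp, constSection_naturality_assoc, he]
  refine IsPullback.of_iso hpb ((Over.forget S).mapIso e.symm) (Iso.refl _) (Iso.refl _)
    (Iso.refl _) ?_ ?_ (by simp) (by simp)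
  · rw [← h1]; exact (congrArg Over.Hom.left (e.inv_hom_id_assoc i')).symm
  · rw [← h2]; exact (congrArg Over.Hom.left (e.inv_hom_id_assoc p)).symm

/-- Universality of a family for `X` may be tested over an open cover of `X`. -/
theorem IsUniversalFamily.of_openCover [Surjective σ] {X Z : Over S} (v : Z ⊗ D ⟶ X)
    (𝒰 : X.left.OpenCover) (Zi : 𝒰.I₀ → Over S) (c : ∀ i, Zi i ⟶ Z)
    (u : ∀ i, Zi i ⊗ D ⟶ overRestrict X (𝒰.f i)) (hu : ∀ i, IsUniversalFamily (u i))
    (hv : ∀ i, c i ▷ D ≫ v = u i ≫ overRestrictHom X (𝒰.f i))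
    (hpb : ∀ i, IsPullback (c i).left (familyBase σ hσ (u i)).left (familyBase σ hσ v).left
      (𝒰.f i)) : IsUniversalFamily v := by
  have hop (i) : IsOpenImmersion (overRestrictHom X (𝒰.f i)).left := 𝒰.map_prop i
  have hmono (i) : Mono (overRestrictHom X (𝒰.f i)) := overMono_of_isOpenImmersion _
  have key : ∀ (Y : Over S) (b : Y ⟶ X) (i : 𝒰.I₀),
      ∃ a : overRestrict Y (pullback.fst b.left (𝒰.f i)) ⟶ overRestrict X (𝒰.f i),
        a ≫ overRestrictHom X (𝒰.f i) = overRestrictHom Y _ ≫ b := fun Y b i ↦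
    ⟨Over.homMk (pullback.snd b.left (𝒰.f i)) (by
      change pullback.snd _ _ ≫ 𝒰.f i ≫ X.hom = pullback.fst _ _ ≫ Y.hom
      rw [← pullback.condition_assoc, Over.w]), Over.OverMorphism.ext pullback.condition.symm⟩
  have hinj : ∀ (Y : Over S) (g h : Y ⟶ Z), g ▷ D ≫ v = h ▷ D ≫ v → g = h := by
    intro Y g g' hgg
    -- Morphisms classifying the same family have the same base. Over the preimage of a chart both
    -- therefore factor through `Zi i`, where universality of `u i` identifies them.
    have hb : g ≫ familyBase σ hσ v = g' ≫ familyBase σ hσ v := by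
      rw [constSection_naturality_assoc, constSection_naturality_assoc, hgg]
    suffices h : ∀ i : 𝒰.I₀,
        overRestrictHom Y (pullback.fst (g ≫ familyBase σ hσ v).left (𝒰.f i)) ≫ g =
          overRestrictHom Y (pullback.fst (g ≫ familyBase σ hσ v).left (𝒰.f i)) ≫ g' from
      Over.hom_ext_openCover (𝒰.pullback₁ (g ≫ familyBase σ hσ v).left) h
    intro i
    obtain ⟨a, ha⟩ := key Y (g ≫ familyBase σ hσ v) i
    set ι := overRestrictHom Y (pullback.fst (g ≫ familyBase σ hσ v).left (𝒰.f i)) with hι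
    have lift : ∀ q : Y ⟶ Z, a ≫ overRestrictHom X (𝒰.f i) = ι ≫ q ≫ familyBase σ hσ v →
        ∃ h : overRestrict Y (pullback.fst (g ≫ familyBase σ hσ v).left (𝒰.f i)) ⟶ Zi i,
          h ≫ c i = ι ≫ q := by
      intro q hq
      have hq' : (ι ≫ q).left ≫ (familyBase σ hσ v).left = a.left ≫ 𝒰.f i :=
        (congrArg Over.Hom.left hq).symm
      refine ⟨Over.homMk ((hpb i).lift (ι ≫ q).left a.left hq') ?_,
        Over.OverMorphism.ext ((hpb i).lift_fst _ _ hq')⟩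
      have := congrArg (· ≫ Z.hom) ((hpb i).lift_fst _ _ hq')
      rw [Category.assoc, Over.w] at this
      exact this.trans (Over.w (ι ≫ q))
    obtain ⟨h, hh⟩ := lift g ha
    obtain ⟨h', hh'⟩ := lift g' (ha.trans (congrArg (ι ≫ ·) hb))
    have : h = h' := by
      refine (hu i _).1 ?_
      dsimp only
      rw [← cancel_mono (overRestrictHom X (𝒰.f i)), Category.assoc, Category.assoc, ← hv,
        ← comp_whiskerRight_assoc, ← comp_whiskerRight_assoc, hh, hh', comp_whiskerRight_assoc,
        comp_whiskerRight_assoc, hgg]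
    rw [← hh, ← hh', this]
  refine fun Y ↦ ⟨fun g g' ↦ hinj Y g g', fun f ↦ ?_⟩
  suffices h : ∀ i : 𝒰.I₀,
      ∃ g : overRestrict Y (pullback.fst (constSection σ hσ Y ≫ f).left (𝒰.f i)) ⟶ Z,
        g ▷ D ≫ v = overRestrictHom Y (pullback.fst (constSection σ hσ Y ≫ f).left (𝒰.f i)) ▷ D ≫ f
    from exists_classifying_of_openCover hinj f (𝒰.pullback₁ (constSection σ hσ Y ≫ f).left) h
  intro i
  obtain ⟨a, ha⟩ := key Y (constSection σ hσ Y ≫ f) i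
  obtain ⟨f', hf'⟩ := exists_lift_of_isOpenImmersion σ hσ
    (overRestrictHom Y (pullback.fst (constSection σ hσ Y ≫ f).left (𝒰.f i)) ▷ D ≫ f)
    (overRestrictHom X (𝒰.f i)) a (by rw [ha, constSection_naturality_assoc])
  obtain ⟨g, hg⟩ := (hu i _).2 f'
  refine ⟨g ≫ c i, ?_⟩
  rw [comp_whiskerRight_assoc, hv, ← hf', ← hg, Category.assoc]

lemma exists_section_overRestrictTensor (Y D : Over S) {V : Scheme.{u}} (f : V ⟶ Y.left) :
    ∃ r : overRestrict Y f ⊗ D ⟶ overRestrict (Y ⊗ D) (pullback.fst (fst Y D).left f),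
      r ≫ overRestrictTensor Y D f = 𝟙 _ ∧ r ≫ overRestrictHom (Y ⊗ D) _ =
        overRestrictHom Y f ▷ D := by
  have h : (overRestrictHom Y f ▷ D).left ≫ (fst Y D).left = (fst (overRestrict Y f) D).left ≫ f :=
    congrArg Over.Hom.left (whiskerRight_fst (overRestrictHom Y f) D)
  let r : overRestrict Y f ⊗ D ⟶ overRestrict (Y ⊗ D) (pullback.fst (fst Y D).left f) :=
    Over.homMk (pullback.lift _ _ h) (by
      change _ ≫ pullback.fst _ _ ≫ _ = _
      rw [pullback.lift_fst_assoc, Over.w])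
  have hr : r ≫ overRestrictHom (Y ⊗ D) _ = overRestrictHom Y f ▷ D :=
    Over.OverMorphism.ext (pullback.lift_fst _ _ h)
  refine ⟨r, ?_, hr⟩
  apply CartesianMonoidalCategory.hom_ext
  · rw [Category.assoc, overRestrictTensor, lift_fst, Category.id_comp]
    exact Over.OverMorphism.ext (pullback.lift_snd _ _ h)
  · rw [Category.assoc, overRestrictTensor, lift_snd, reassoc_of% hr, whiskerRight_snd,
      Category.id_comp]

lemma exists_glue_of_locallyDirected_pullback {X Y Y' : Scheme.{u}} (𝒰 : Y.OpenCover)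
    [Category* 𝒰.I₀] [𝒰.LocallyDirected] (q : Y' ⟶ Y)
    (g : ∀ i : 𝒰.I₀, pullback q (𝒰.f i) ⟶ X)
    (h : ∀ {i j : 𝒰.I₀} (hij : i ⟶ j), pullback.map q (𝒰.f i) q (𝒰.f j) (𝟙 _) (𝒰.trans hij) (𝟙 _)
      (by simp) (by simp) ≫ g j = g i) :
    ∃ v : Y' ⟶ X, ∀ i : 𝒰.I₀, pullback.fst q (𝒰.f i) ≫ v = g i :=
  ⟨Scheme.OpenCover.glueMorphismsOfLocallyDirected (𝒰.pullback₁ q) g h, fun i ↦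
    Scheme.OpenCover.map_glueMorphismsOfLocallyDirected (𝒰.pullback₁ q) g h i⟩

/-- Families over a locally directed open cover that are compatible with the transition maps
glue. -/
lemma exists_tensor_hom_of_locallyDirected {X Y : Over S} (𝒰 : Y.left.OpenCover)
    [Category* 𝒰.I₀] [𝒰.LocallyDirected] (f : ∀ i, overRestrict Y (𝒰.f i) ⊗ D ⟶ X)
    (hf : ∀ (i j : 𝒰.I₀) (hij : i ⟶ j) (t : overRestrict Y (𝒰.f i) ⟶ overRestrict Y (𝒰.f j)),
      t.left = 𝒰.trans hij → t ▷ D ≫ f j = f i) :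
    ∃ v : Y ⊗ D ⟶ X, ∀ i, overRestrictHom Y (𝒰.f i) ▷ D ≫ v = f i := by
  let q := (fst Y D).left
  have hcomp : ∀ {i j : 𝒰.I₀} (hij : i ⟶ j),
      pullback.map q (𝒰.f i) q (𝒰.f j) (𝟙 _) (𝒰.trans hij) (𝟙 _) (by simp) (by simp) ≫
        (overRestrictTensor Y D (𝒰.f j) ≫ f j).left =
          (overRestrictTensor Y D (𝒰.f i) ≫ f i).left := by
    intro i j hij
    let t : overRestrict Y (𝒰.f i) ⟶ overRestrict Y (𝒰.f j) := Over.homMk (𝒰.trans hij) (by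
      change 𝒰.trans hij ≫ 𝒰.f j ≫ Y.hom = 𝒰.f i ≫ Y.hom
      rw [← Category.assoc, 𝒰.trans_map])
    let t' : overRestrict (Y ⊗ D) (pullback.fst q (𝒰.f i)) ⟶
        overRestrict (Y ⊗ D) (pullback.fst q (𝒰.f j)) :=
      Over.homMk (pullback.map q (𝒰.f i) q (𝒰.f j) (𝟙 _) (𝒰.trans hij) (𝟙 _) (by simp) (by simp))
        (by
          change pullback.lift _ _ _ ≫ pullback.fst q (𝒰.f j) ≫ _ = pullback.fst q (𝒰.f i) ≫ _
          rw [pullback.lift_fst_assoc, Category.comp_id])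
    have h1 : t' ≫ overRestrictTensor Y D (𝒰.f j) = overRestrictTensor Y D (𝒰.f i) ≫ t ▷ D := by
      apply CartesianMonoidalCategory.hom_ext
      · rw [Category.assoc, Category.assoc, whiskerRight_fst, overRestrictTensor, lift_fst,
          overRestrictTensor, lift_fst_assoc]
        ext1
        exact pullback.lift_snd _ _ _
      · have h0 : t' ≫ overRestrictHom (Y ⊗ D) (pullback.fst q (𝒰.f j)) =
            overRestrictHom (Y ⊗ D) (pullback.fst q (𝒰.f i)) := Over.OverMorphism.ext (by
          change pullback.lift _ _ _ ≫ pullback.fst q (𝒰.f j) = pullback.fst q (𝒰.f i)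
          rw [pullback.lift_fst, Category.comp_id])
        rw [Category.assoc, Category.assoc, whiskerRight_snd, overRestrictTensor, lift_snd,
          overRestrictTensor, lift_snd, reassoc_of% h0]
    have h2 : t' ≫ overRestrictTensor Y D (𝒰.f j) ≫ f j = overRestrictTensor Y D (𝒰.f i) ≫ f i := by
      rw [reassoc_of% h1, hf i j hij t rfl]
    exact congrArg Over.Hom.left h2
  obtain ⟨v₀, hv₀⟩ : ∃ v₀ : (Y ⊗ D).left ⟶ X.left, ∀ i : 𝒰.I₀, pullback.fst q (𝒰.f i) ≫ v₀ =
      (overRestrictTensor Y D (𝒰.f i) ≫ f i).left :=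
    exists_glue_of_locallyDirected_pullback 𝒰 q _ hcomp
  have hw : v₀ ≫ X.hom = (Y ⊗ D).hom := by
    suffices h : ∀ i : 𝒰.I₀, pullback.fst q (𝒰.f i) ≫ v₀ ≫ X.hom =
      pullback.fst q (𝒰.f i) ≫ (Y ⊗ D).hom from
      Scheme.Cover.hom_ext (𝒰.pullback₁ q) _ _ h
    intro i
    rw [reassoc_of% hv₀, Over.w]
    rfl
  obtain ⟨v, hv⟩ : ∃ v : Y ⊗ D ⟶ X, ∀ i : 𝒰.I₀, overRestrictHom (Y ⊗ D) (pullback.fst q (𝒰.f i)) ≫ v =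
      overRestrictTensor Y D (𝒰.f i) ≫ f i :=
    ⟨Over.homMk v₀ hw, fun i ↦ Over.OverMorphism.ext (hv₀ i)⟩
  refine ⟨v, fun i ↦ ?_⟩
  obtain ⟨r, hr, hr'⟩ := exists_section_overRestrictTensor Y D (𝒰.f i)
  rw [← hr', Category.assoc, hv, reassoc_of% hr]

/-- Universal families for the members of a locally directed open cover of `X` glue to a universal
family for `X`. -/
theorem exists_isUniversalFamily_of_openCover {σ : S ⟶ D.left} (hσ : σ ≫ D.hom = 𝟙 S)
    [Surjective σ] (X : Over S)
    (𝒰 : X.left.OpenCover) [Category* 𝒰.I₀] [𝒰.LocallyDirected] [Small.{u} 𝒰.I₀]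
    [Quiver.IsThin 𝒰.I₀]
    (h : ∀ i, ∃ (Z : Over S) (u : Z ⊗ D ⟶ overRestrict X (𝒰.f i)), IsUniversalFamily u) :
    ∃ (Z : Over S) (v : Z ⊗ D ⟶ X), IsUniversalFamily v := by
  choose Z u hu using h
  let t {i j : 𝒰.I₀} (hij : i ⟶ j) : overRestrict X (𝒰.f i) ⟶ overRestrict X (𝒰.f j) :=
    Over.homMk (𝒰.trans hij) (by
      change 𝒰.trans hij ≫ 𝒰.f j ≫ X.hom = 𝒰.f i ≫ X.hom
      rw [← Category.assoc, 𝒰.trans_map])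
  have ht_id (i : 𝒰.I₀) : t (𝟙 i) = 𝟙 _ := Over.OverMorphism.ext (𝒰.trans_id i)
  have ht_comp {i j l : 𝒰.I₀} (hij : i ⟶ j) (hjl : j ⟶ l) : t (hij ≫ hjl) = t hij ≫ t hjl :=
    Over.OverMorphism.ext (𝒰.trans_comp hij hjl)
  have ht {i j : 𝒰.I₀} (hij : i ⟶ j) : t hij ≫ overRestrictHom X (𝒰.f j) =
      overRestrictHom X (𝒰.f i) := Over.OverMorphism.ext (𝒰.trans_map hij)
  have hopen {i j : 𝒰.I₀} (hij : i ⟶ j) : IsOpenImmersion (t hij).left :=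
    inferInstanceAs (IsOpenImmersion (𝒰.trans hij))
  have hz (i j : 𝒰.I₀) (hij : i ⟶ j) : ∃ z : Z i ⟶ Z j, z ▷ D ≫ u j = u i ≫ t hij :=
    (hu j (Z i)).2 (u i ≫ t hij)
  choose z hz using hz
  let F : 𝒰.I₀ ⥤ Over S :=
    { obj := Z
      map := fun {i j} hij ↦ z i j hij
      map_id := fun i ↦ (hu i _).1 (by
        dsimp only; rw [hz, ht_id, id_whiskerRight, Category.id_comp, Category.comp_id])
      map_comp := fun {i j l} hij hjl ↦ (hu l _).1 (by
        dsimp only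
        rw [hz, ht_comp, comp_whiskerRight_assoc, hz, ← reassoc_of% hz]) }
  let b (i : 𝒰.I₀) := familyBase σ hσ (u i)
  have hb {i j : 𝒰.I₀} (hij : i ⟶ j) : z i j hij ≫ b j = b i ≫ t hij := by
    rw [constSection_naturality_assoc, hz, Category.assoc]
  -- The charts form a gluing datum relative to `X` because each transition square is cartesian:
  -- over a smaller open, the parameter space is the preimage of that open.
  let d : 𝒰.RelativeGluingData :=
    { functor := F ⋙ Over.forget S
      natTrans :=
        { app := fun i ↦ (b i).left
          naturality := fun i j hij ↦ congrArg Over.Hom.left (hb hij) }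
      equifibered := fun i j hij ↦
        (hu j).isPullback σ hσ (hu i) (t hij) (z i j hij) (hz i j hij) }
  let Zg : Over S := Over.mk (d.toBase ≫ X.hom)
  let g (i : 𝒰.I₀) : (Z i).left ⟶ Zg.left := d.cover.f i
  have hg (i : 𝒰.I₀) : g i ≫ d.toBase = (b i).left ≫ 𝒰.f i := d.ι_toBase i
  have hw (i : 𝒰.I₀) : g i ≫ d.toBase ≫ X.hom = (Z i).hom := by
    have hbi : (b i).left ≫ 𝒰.f i ≫ X.hom = (Z i).hom := Over.w (b i)
    rw [← Category.assoc, hg, Category.assoc, hbi]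
  let c (i : 𝒰.I₀) : Z i ⟶ Zg := Over.homMk (g i) (hw i)
  let a (i : 𝒰.I₀) : overRestrict Zg (g i) ≅ Z i := Over.isoMk (Iso.refl _)
    ((Category.id_comp _).trans (hw i).symm)
  have hac (i : 𝒰.I₀) : (a i).inv ≫ overRestrictHom Zg (g i) = c i :=
    Over.OverMorphism.ext (Category.id_comp _)
  have hcompat (i j : 𝒰.I₀) (hij : i ⟶ j) (t' : overRestrict Zg (g i) ⟶ overRestrict Zg (g j))
      (ht' : t'.left = (z i j hij).left) :
      t' ▷ D ≫ (a j).hom ▷ D ≫ u j ≫ overRestrictHom X (𝒰.f j) =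
        (a i).hom ▷ D ≫ u i ≫ overRestrictHom X (𝒰.f i) := by
    have h1 : t' ≫ (a j).hom = (a i).hom ≫ z i j hij := by
      ext1
      change t'.left ≫ 𝟙 _ = 𝟙 _ ≫ (z i j hij).left
      rw [ht', Category.comp_id, Category.id_comp]
    rw [← comp_whiskerRight_assoc, h1, comp_whiskerRight_assoc, reassoc_of% hz, ht]
  obtain ⟨v, hv⟩ : ∃ v : Zg ⊗ D ⟶ X, ∀ i : 𝒰.I₀, overRestrictHom Zg (g i) ▷ D ≫ v =
      (a i).hom ▷ D ≫ u i ≫ overRestrictHom X (𝒰.f i) :=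
    exists_tensor_hom_of_locallyDirected (X := X) (Y := Zg) (D := D) d.cover
      (fun i : 𝒰.I₀ ↦ (a i).hom ▷ D ≫ u i ≫ overRestrictHom X (𝒰.f i)) hcompat
  have hcv (i : 𝒰.I₀) : c i ▷ D ≫ v = u i ≫ overRestrictHom X (𝒰.f i) := by
    rw [← hac, comp_whiskerRight_assoc, hv, ← comp_whiskerRight_assoc, Iso.inv_hom_id,
      id_whiskerRight, Category.id_comp]
  have hbase : (familyBase σ hσ v).left = d.toBase := by
    suffices h : ∀ i : 𝒰.I₀, g i ≫ (familyBase σ hσ v).left = g i ≫ d.toBase from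
      Scheme.Cover.hom_ext d.cover _ _ h
    intro i
    rw [hg]
    have : c i ≫ familyBase σ hσ v = b i ≫ overRestrictHom X (𝒰.f i) := by
      rw [constSection_naturality_assoc, hcv, Category.assoc]
    exact congrArg Over.Hom.left this
  refine ⟨Zg, v, .of_openCover σ hσ v 𝒰 Z c u hu hcv fun i ↦ ?_⟩
  rw [hbase]
  exact (d.isPullback_natTrans_ι_toBase i).flip

end UniversalFamilyGluing

/-! ### From algebras to affine schemes over a field -/

section SpecOver

open CartesianMonoidalCategory TensorProduct

variable {k : Type u} [Field k]

/-- The spectrum of a `k`-algebra as a scheme over `k`. -/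
noncomputable abbrev specOver (k B : Type u) [Field k] [CommRing B] [Algebra k B] :
    Over (Spec (CommRingCat.of k)) :=
  Over.mk (Spec.map (CommRingCat.ofHom (algebraMap k B)))

variable {A B C D D' E : Type u} [CommRing A] [Algebra k A] [CommRing B] [Algebra k B] [CommRing C]
  [Algebra k C] [CommRing D] [Algebra k D] [CommRing D'] [Algebra k D'] [CommRing E] [Algebra k E]

/-- The morphism of spectra over `k` induced by a homomorphism of `k`-algebras. -/
noncomputable def specOverMap (φ : A →ₐ[k] B) : specOver k B ⟶ specOver k A :=
  Over.homMk (Spec.map (CommRingCat.ofHom φ.toRingHom)) (by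
    change Spec.map _ ≫ Spec.map _ = Spec.map _
    rw [← Spec.map_comp, ← CommRingCat.ofHom_comp]
    congr 2
    exact φ.comp_algebraMap)

lemma specOverMap_id : specOverMap (AlgHom.id k A) = 𝟙 _ :=
  Over.OverMorphism.ext (Spec.map_id _)

lemma specOverMap_comp (φ : A →ₐ[k] B) (ψ : B →ₐ[k] C) :
    specOverMap ψ ≫ specOverMap φ = specOverMap (ψ.comp φ) :=
  Over.OverMorphism.ext (Spec.map_comp _ _).symm

lemma specOverMap_bijective :
    Function.Bijective (specOverMap : (A →ₐ[k] B) → (specOver k B ⟶ specOver k A)) := by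
  refine ⟨fun φ ψ h ↦ ?_, fun g ↦ ?_⟩
  · have h1 := Spec.map_injective (congrArg Over.Hom.left h)
    ext x
    exact congrArg (fun f ↦ f.hom x) h1
  · obtain ⟨f, hf⟩ := Spec.map_surjective g.left
    have hw := Over.w g
    change g.left ≫ Spec.map _ = Spec.map _ at hw
    rw [← hf, ← Spec.map_comp] at hw
    have hw := Spec.map_injective hw
    refine ⟨{ f.hom with commutes' := fun r ↦ congrArg (fun q ↦ q.hom r) hw }, ?_⟩
    exact Over.OverMorphism.ext hf

/-- The fibre product of spectra is the spectrum of the tensor product. -/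
noncomputable def specOverTensorIso (k B D : Type u) [Field k] [CommRing B] [Algebra k B]
    [CommRing D] [Algebra k D] : specOver k B ⊗ specOver k D ≅ specOver k (B ⊗[k] D) :=
  Over.isoMk (pullbackSpecIso k B D) (pullbackSpecIso_hom_base k B D)

lemma specOverTensorIso_inv_fst : (specOverTensorIso k B D).inv ≫ fst _ _ =
    specOverMap Algebra.TensorProduct.includeLeft :=
  Over.OverMorphism.ext (pullbackSpecIso_inv_fst k B D)

lemma specOverTensorIso_inv_snd : (specOverTensorIso k B D).inv ≫ snd _ _ =
    specOverMap Algebra.TensorProduct.includeRight :=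
  Over.OverMorphism.ext (pullbackSpecIso_inv_snd k B D)

lemma specOverTensorIso_inv_naturality (φ : A →ₐ[k] B) (ψ : D →ₐ[k] E) :
    (specOverTensorIso k B E).inv ≫ (specOverMap φ ⊗ₘ specOverMap ψ) =
      specOverMap (Algebra.TensorProduct.map φ ψ) ≫ (specOverTensorIso k A D).inv := by
  apply CartesianMonoidalCategory.hom_ext
  · rw [Category.assoc, Category.assoc, tensorHom_fst, specOverTensorIso_inv_fst,
      ← Category.assoc, specOverTensorIso_inv_fst, specOverMap_comp, specOverMap_comp]
    congr 1
    ext; simp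
  · rw [Category.assoc, Category.assoc, tensorHom_snd, specOverTensorIso_inv_snd,
      ← Category.assoc, specOverTensorIso_inv_snd, specOverMap_comp, specOverMap_comp]
    congr 1
    ext; simp

lemma specOverTensorIso_naturality (φ : A →ₐ[k] B) (ψ : D →ₐ[k] E) :
    (specOverMap φ ⊗ₘ specOverMap ψ) ≫ (specOverTensorIso k A D).hom =
      (specOverTensorIso k B E).hom ≫ specOverMap (Algebra.TensorProduct.map φ ψ) := by
  rw [← Iso.inv_comp_eq, ← Category.assoc, specOverTensorIso_inv_naturality, Category.assoc,
    Iso.inv_hom_id, Category.comp_id]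

/-- The family `Spec B × Spec D ⟶ Spec A` given by a homomorphism `A → B ⊗ D`. -/
noncomputable def specOverFamily (α : A →ₐ[k] B ⊗[k] D) :
    specOver k B ⊗ specOver k D ⟶ specOver k A :=
  (specOverTensorIso k B D).hom ≫ specOverMap α

lemma specOverFamily_bijective : Function.Bijective
    (specOverFamily : (A →ₐ[k] B ⊗[k] D) → (specOver k B ⊗ specOver k D ⟶ specOver k A)) :=
  ((specOverTensorIso k B D).symm.homFromEquiv.bijective).comp specOverMap_bijective

lemma specOverMap_whiskerRight_specOverFamily (φ : B →ₐ[k] C) (α : A →ₐ[k] B ⊗[k] D) :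
    specOverMap φ ▷ specOver k D ≫ specOverFamily α =
      specOverFamily ((Algebra.TensorProduct.map φ (AlgHom.id k D)).comp α) := by
  rw [← tensorHom_id, ← specOverMap_id, specOverFamily, ← Category.assoc,
    specOverTensorIso_naturality, Category.assoc, specOverMap_comp, specOverFamily]

lemma specOverMap_whiskerLeft_specOverFamily (ρ : D' →ₐ[k] D) (α : A →ₐ[k] B ⊗[k] D') :
    specOver k B ◁ specOverMap ρ ≫ specOverFamily α =
      specOverFamily ((Algebra.TensorProduct.map (AlgHom.id k B) ρ).comp α) := by
  rw [← id_tensorHom, ← specOverMap_id, specOverFamily, ← Category.assoc,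
    specOverTensorIso_naturality, Category.assoc, specOverMap_comp, specOverFamily]

lemma exists_iso_specOver (Y : Over (Spec (CommRingCat.of k))) [IsAffine Y.left] :
    ∃ (B : Type u) (_ : CommRing B) (_ : Algebra k B), Nonempty (Y ≅ specOver k B) := by
  let f : CommRingCat.of k ⟶ Γ(Y.left, ⊤) := Spec.preimage (Y.left.isoSpec.inv ≫ Y.hom)
  let _ : Algebra k Γ(Y.left, ⊤) := f.hom.toAlgebra
  refine ⟨Γ(Y.left, ⊤), inferInstance, inferInstance, ⟨Over.isoMk Y.left.isoSpec ?_⟩⟩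
  have : Spec.map f = Y.left.isoSpec.inv ≫ Y.hom := Spec.map_preimage _
  change Y.left.isoSpec.hom ≫ Spec.map f = Y.hom
  rw [this, Iso.hom_inv_id_assoc]

/-- An algebraic universal family gives a universal family of schemes. -/
theorem AlgHom.IsUniversalFamily.isUniversalFamily_specOverFamily {υ : A →ₐ[k] B ⊗[k] D} (hυ : υ.IsUniversalFamily) :
    _root_.IsUniversalFamily (specOverFamily υ) := by
  refine .of_isAffine fun Y hY ↦ ?_
  obtain ⟨C, _, _, ⟨e⟩⟩ := exists_iso_specOver Y
  have h1 : Function.Bijective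
      fun g : specOver k C ⟶ specOver k B ↦ g ▷ specOver k D ≫ specOverFamily υ := by
    rw [← Function.Bijective.of_comp_iff _ specOverMap_bijective]
    convert specOverFamily_bijective.comp (hυ C) using 1
    ext1 φ
    exact specOverMap_whiskerRight_specOverFamily φ υ
  have h2 := ((whiskerRightIso e (specOver k D)).symm.homFromEquiv.bijective.comp h1).comp
    e.homFromEquiv.bijective
  convert h2 using 1
  ext1 g
  simp

end SpecOver

/-! ### Truncation morphisms and localization on the target -/

section Truncation

open CartesianMonoidalCategory Limits

variable {S : Scheme.{u}} {D D' : Over S} {ι : D ⟶ D'} {X U Z Z' W W' : Over S}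
  {u : Z ⊗ D ⟶ X} {u' : Z' ⊗ D' ⟶ X} {w : W ⊗ D ⟶ U} {w' : W' ⊗ D' ⟶ U}

/-- The morphism `ψ` classifies the restriction of the family `u'` along `ι : D ⟶ D'`. -/
def IsTruncation (ι : D ⟶ D') (u : Z ⊗ D ⟶ X) (u' : Z' ⊗ D' ⟶ X) (ψ : Z' ⟶ Z) : Prop :=
  ψ ▷ D ≫ u = Z' ◁ ι ≫ u'

/-- Both composites classify the restriction along `ι` of `w' ≫ j`. -/
lemma IsTruncation.comm (hu : IsUniversalFamily u) {ψ : Z' ⟶ Z} {ξ : W' ⟶ W}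
    (hψ : IsTruncation ι u u' ψ) (hξ : IsTruncation ι w w' ξ) {j : U ⟶ X} {a : W ⟶ Z} {a' : W' ⟶ Z'}
    (ha : a ▷ D ≫ u = w ≫ j) (ha' : a' ▷ D' ≫ u' = w' ≫ j) : a' ≫ ψ = ξ ≫ a := by
  refine (hu _).1 ?_
  dsimp only
  rw [comp_whiskerRight_assoc, hψ, ← whisker_exchange_assoc, ha', comp_whiskerRight_assoc, ha,
    ← Category.assoc, ← hξ, Category.assoc]

lemma constSection_whiskerLeft (σ : S ⟶ D.left) (hσ : σ ≫ D.hom = 𝟙 S)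
    (hσ' : (σ ≫ ι.left) ≫ D'.hom = 𝟙 S) (Y : Over S) :
    constSection σ hσ Y ≫ Y ◁ ι = constSection (σ ≫ ι.left) hσ' Y := by
  apply CartesianMonoidalCategory.hom_ext
  · simp [constSection]
  · simp only [constSection, lift_whiskerLeft, lift_snd]
    ext1
    simp

lemma IsTruncation.comp_familyBase {ψ : Z' ⟶ Z} (hψ : IsTruncation ι u u' ψ) (σ : S ⟶ D.left)
    (hσ : σ ≫ D.hom = 𝟙 S) (hσ' : (σ ≫ ι.left) ≫ D'.hom = 𝟙 S) :
    ψ ≫ familyBase σ hσ u = familyBase (σ ≫ ι.left) hσ' u' := by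
  rw [constSection_naturality_assoc, hψ, ← Category.assoc, constSection_whiskerLeft σ hσ hσ']

/-- The truncation morphism over an open subscheme is the restriction of the truncation morphism. -/
theorem IsTruncation.isPullback (hu : IsUniversalFamily u) (hu' : IsUniversalFamily u')
    (hw : IsUniversalFamily w) (hw' : IsUniversalFamily w') {ψ : Z' ⟶ Z} {ξ : W' ⟶ W}
    (hψ : IsTruncation ι u u' ψ) (hξ : IsTruncation ι w w' ξ) (σ : S ⟶ D.left)
    (hσ : σ ≫ D.hom = 𝟙 S) [Surjective σ] [Surjective (σ ≫ ι.left)] {j : U ⟶ X}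
    [IsOpenImmersion j.left] {a : W ⟶ Z} {a' : W' ⟶ Z'}
    (ha : a ▷ D ≫ u = w ≫ j) (ha' : a' ▷ D' ≫ u' = w' ≫ j) :
    IsPullback a'.left ξ.left ψ.left a.left := by
  have hσ' : (σ ≫ ι.left) ≫ D'.hom = 𝟙 S := by rw [Category.assoc, Over.w, hσ]
  have h1 := hu.isPullback σ hσ hw j a ha
  have h2 := hu'.isPullback (σ ≫ ι.left) hσ' hw' j a' ha'
  rw [← hψ.comp_familyBase σ hσ hσ', ← hξ.comp_familyBase σ hσ hσ', Over.comp_left,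
    Over.comp_left] at h2
  -- Both `W → Z` and `W' → Z'` are preimages of `U`, and truncation preserves the base; cancelling
  -- one cartesian square from the other leaves the required one.
  exact (IsPullback.of_right h2.flip (congrArg Over.Hom.left (hψ.comm hu hξ ha ha')).symm
    h1.flip).flip

/-- Flatness of a truncation morphism may be checked over an open cover of `X`. -/
theorem IsTruncation.flat_of_openCover (hu : IsUniversalFamily u) (hu' : IsUniversalFamily u')
    {ψ : Z' ⟶ Z} (hψ : IsTruncation ι u u' ψ) (σ : S ⟶ D.left)
    (hσ : σ ≫ D.hom = 𝟙 S) [Surjective σ] [Surjective (σ ≫ ι.left)] (𝒰 : X.left.OpenCover)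
    (h : ∀ i, ∃ (W W' : Over S) (w : W ⊗ D ⟶ overRestrict X (𝒰.f i))
      (w' : W' ⊗ D' ⟶ overRestrict X (𝒰.f i)) (ξ : W' ⟶ W), IsUniversalFamily w ∧
        IsUniversalFamily w' ∧ IsTruncation ι w w' ξ ∧ Flat ξ.left) : Flat ψ.left := by
  have hσ' : (σ ≫ ι.left) ≫ D'.hom = 𝟙 S := by rw [Category.assoc, Over.w, hσ]
  have : IsZariskiLocalAtSource (@Flat.{u}) := HasRingHomProperty.instIsZariskiLocalAtSource
  suffices h : ∀ i : 𝒰.I₀, Flat (pullback.fst (familyBase (σ ≫ ι.left) hσ' u').left (𝒰.f i) ≫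
      ψ.left) from IsZariskiLocalAtSource.of_openCover
        (𝒰.pullback₁ (familyBase (σ ≫ ι.left) hσ' u').left) h
  intro i
  obtain ⟨W, W', w, w', ξ, hw, hw', hξ, hflat⟩ := h i
  have : IsOpenImmersion (overRestrictHom X (𝒰.f i)).left := 𝒰.map_prop i
  obtain ⟨a, ha⟩ := (hu W).2 (w ≫ overRestrictHom X (𝒰.f i))
  obtain ⟨a', ha'⟩ := (hu' W').2 (w' ≫ overRestrictHom X (𝒰.f i))
  have h1 := hu.isPullback σ hσ hw _ a ha
  have h2 := hu'.isPullback (σ ≫ ι.left) hσ' hw' _ a' ha'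
  have : IsOpenImmersion a.left := MorphismProperty.of_isPullback h1.flip ‹_›
  have h3 : a'.left ≫ ψ.left = ξ.left ≫ a.left :=
    congrArg Over.Hom.left (hψ.comm hu hξ ha ha')
  obtain ⟨e, he⟩ : ∃ e : pullback (familyBase (σ ≫ ι.left) hσ' u').left (𝒰.f i) ≅ W'.left,
      pullback.fst (familyBase (σ ≫ ι.left) hσ' u').left (𝒰.f i) = e.hom ≫ a'.left :=
    ⟨h2.isoPullback.symm, h2.isoPullback_inv_fst.symm⟩
  rw [he, Category.assoc, h3]
  infer_instance

end Truncation

/-! ### Jet schemes as universal families -/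

section JetScheme

variable {k : Type u} [Field k] {X : Over (Spec (CommRingCat.of k))} {m m' : ℕ}

lemma JetScheme.isUniversalFamily (J : JetScheme X m) : IsUniversalFamily J.universal := by
  intro Y
  have h (g : Y ⟶ J.scheme) : J.representableBy.homEquiv g = g ▷ jetDisc k m ≫ J.universal :=
    J.representableBy.homEquiv_eq g
  refine ⟨fun g g' hgg ↦ J.representableBy.homEquiv.injective ?_, fun f ↦ ?_⟩
  · rw [h, h]
    exact hgg
  · exact ⟨J.representableBy.homEquiv.symm f,
      (h _).symm.trans (J.representableBy.homEquiv.apply_symm_apply f)⟩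

lemma JetScheme.isTruncation_truncation (h : m ≤ m') (J' : JetScheme X m') (J : JetScheme X m) :
    IsTruncation (jetDisc.incl k h) J.universal J'.universal (JetScheme.truncation h J' J) := by
  refine (J.representableBy.homEquiv_eq (JetScheme.truncation h J' J)).symm.trans ?_
  exact J.representableBy.homEquiv.apply_symm_apply _

lemma IsUniversalFamily.nonempty_jetScheme {Z : Over (Spec (CommRingCat.of k))}
    {u : Z ⊗ jetDisc k m ⟶ X} (hu : IsUniversalFamily u) : Nonempty (JetScheme X m) :=
  ⟨Z, { homEquiv := fun {Y} ↦ Equiv.ofBijective (fun g : Y ⟶ Z ↦ g ▷ jetDisc k m ≫ u) (hu Y)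
        homEquiv_comp := fun f g ↦ comp_whiskerRight_assoc f g _ u }⟩

end JetScheme

/-! ### The truncated polynomial ring and its unique point -/

section JetRing

open Polynomial

variable (k : Type u) [Field k] {m m' : ℕ}

instance JetRing.finite (m : ℕ) : Module.Finite k (JetRing k m) :=
  (monic_X_pow (R := k) (m + 1)).finite_quotient

lemma JetRing.reduction_surjective (h : m ≤ m') : Function.Surjective (JetRing.reduction k h) := by
  intro x
  obtain ⟨p, rfl⟩ := Ideal.Quotient.mk_surjective x
  exact ⟨Ideal.Quotient.mk _ p, rfl⟩

/-- The evaluation of truncated polynomials at `0`. -/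
noncomputable def JetRing.eval (m : ℕ) : JetRing k m →ₐ[k] k :=
  Ideal.Quotient.liftₐ _ (aeval 0) (by
    have : Ideal.span {(X : k[X]) ^ (m + 1)} ≤ RingHom.ker (aeval (R := k) (0 : k)) := by
      rw [Ideal.span_singleton_le_iff_mem, RingHom.mem_ker]
      simp
    exact fun a ha ↦ this ha)

lemma JetRing.isNilpotent_of_eval_eq_zero (x : JetRing k m) (hx : JetRing.eval k m x = 0) :
    IsNilpotent x := by
  obtain ⟨p, rfl⟩ := Ideal.Quotient.mk_surjective x
  have hp : p.eval 0 = 0 := hx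
  rw [← coeff_zero_eq_eval_zero, ← X_dvd_iff] at hp
  refine ⟨m + 1, ?_⟩
  rw [← map_pow, Ideal.Quotient.eq_zero_iff_mem, Ideal.mem_span_singleton]
  exact pow_dvd_pow_of_dvd hp _

/-- The rational point of the jet disc. -/
noncomputable def jetDisc.point (m : ℕ) : Spec (CommRingCat.of k) ⟶ (jetDisc k m).left :=
  Spec.map (CommRingCat.ofHom (JetRing.eval k m).toRingHom)

lemma jetDisc.point_hom (m : ℕ) : jetDisc.point k m ≫ (jetDisc k m).hom = 𝟙 _ := by
  change Spec.map _ ≫ Spec.map _ = _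
  have h : CommRingCat.ofHom (algebraMap k (JetRing k m)) ≫
      CommRingCat.ofHom (JetRing.eval k m).toRingHom = 𝟙 (CommRingCat.of k) :=
    congrArg CommRingCat.ofHom (JetRing.eval k m).comp_algebraMap
  rw [← Spec.map_comp, h, Spec.map_id]

/-- The kernel of evaluation is maximal and consists of nilpotents, so it is the only prime. -/
lemma JetRing.comap_eval_surjective (m : ℕ) :
    Function.Surjective (PrimeSpectrum.comap (JetRing.eval k m).toRingHom) := by
  refine fun p ↦ ⟨⊥, PrimeSpectrum.ext ?_⟩
  have hle : RingHom.ker (JetRing.eval k m).toRingHom ≤ p.asIdeal := fun x hx ↦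
    nilpotent_iff_mem_prime.mp (JetRing.isNilpotent_of_eval_eq_zero k x hx) _ p.2
  have hmax : (RingHom.ker (JetRing.eval k m).toRingHom).IsMaximal :=
    RingHom.ker_isMaximal_of_surjective _ fun c ↦
      ⟨algebraMap k _ c, (JetRing.eval k m).commutes c⟩
  exact hmax.eq_of_le p.2.ne_top hle

instance jetDisc.surjective_point (m : ℕ) : Surjective (jetDisc.point k m) :=
  ⟨JetRing.comap_eval_surjective k m⟩

lemma JetRing.reduction_mk (h : m ≤ m') (p : k[X]) :
    JetRing.reduction k h (Ideal.Quotient.mk _ p) = Ideal.Quotient.mk _ p := rfl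

lemma JetRing.eval_mk (m : ℕ) (p : k[X]) :
    JetRing.eval k m (Ideal.Quotient.mk _ p) = aeval 0 p := rfl

lemma JetRing.eval_comp_reduction (h : m ≤ m') :
    (JetRing.eval k m).comp (JetRing.reduction k h) = JetRing.eval k m' := by
  refine AlgHom.ext fun x ↦ ?_
  obtain ⟨p, rfl⟩ := Ideal.Quotient.mk_surjective x
  rw [AlgHom.comp_apply, JetRing.reduction_mk, JetRing.eval_mk, JetRing.eval_mk]

lemma jetDisc.point_incl (h : m ≤ m') :
    jetDisc.point k m ≫ (jetDisc.incl k h).left = jetDisc.point k m' := by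
  have h1 : CommRingCat.ofHom (JetRing.reduction k h).toRingHom ≫
      CommRingCat.ofHom (JetRing.eval k m).toRingHom =
        CommRingCat.ofHom (JetRing.eval k m').toRingHom := by
    rw [← CommRingCat.ofHom_comp, ← JetRing.eval_comp_reduction k h]
    rfl
  exact (Spec.map_comp _ _).symm.trans (congrArg Spec.map h1)

/-- The coefficient of `t ^ i` of a truncated polynomial, for `i ≤ m`. -/
noncomputable def JetRing.coeff {i : ℕ} (hi : i ≤ m) : JetRing k m →ₗ[k] k :=
  ((Ideal.span {(X : k[X]) ^ (m + 1)}).restrictScalars k).liftQ (lcoeff k i) (by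
    intro p hp
    rw [Submodule.restrictScalars_mem, Ideal.mem_span_singleton, X_pow_dvd_iff] at hp
    exact hp i (by lia))

lemma JetRing.coeff_mk {i : ℕ} (hi : i ≤ m) (p : k[X]) :
    JetRing.coeff k hi (Ideal.Quotient.mk _ p) = p.coeff i := rfl

/-- The product is divisible by `t^(2m+2)`, and `m + 1 < 2m + 2`. This is what turns the coefficient
of `t^(m+1)` into a derivation. -/
lemma JetRing.coeff_mul_eq_zero (h : m < m') {x y : JetRing k m'}
    (hx : JetRing.reduction k h.le x = 0) (hy : JetRing.reduction k h.le y = 0) :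
    JetRing.coeff k (Nat.succ_le_of_lt h) (x * y) = 0 := by
  obtain ⟨p, rfl⟩ := Ideal.Quotient.mk_surjective x
  obtain ⟨q, rfl⟩ := Ideal.Quotient.mk_surjective y
  rw [JetRing.reduction_mk, Ideal.Quotient.eq_zero_iff_mem, Ideal.mem_span_singleton] at hx hy
  rw [← map_mul, JetRing.coeff_mk]
  have := mul_dvd_mul hx hy
  rw [← pow_add, X_pow_dvd_iff] at this
  exact this _ (by lia)

end JetRing

/-! ### Non-singularity is local -/

section Nonsingular

lemma IsNonsingular.of_isOpenImmersion {X Y : Scheme.{u}} (f : X ⟶ Y) [IsOpenImmersion f]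
    (h : IsNonsingular Y) : IsNonsingular X := fun x ↦ by
  have := h (f x)
  exact IsRegularLocalRing.of_ringEquiv (asIso (f.stalkMap x)).commRingCatIsoToRingEquiv

lemma IsNonsingular.of_openCover {X : Scheme.{u}} (𝒰 : X.OpenCover)
    (h : ∀ i, IsNonsingular (𝒰.X i)) : IsNonsingular X := fun x ↦ by
  obtain ⟨i, y, rfl⟩ := 𝒰.exists_eq x
  have := h i y
  exact IsRegularLocalRing.of_ringEquiv (asIso ((𝒰.f i).stalkMap y)).commRingCatIsoToRingEquiv.symm

lemma isNonsingular_Spec_iff (B : Type u) [CommRing B] : IsNonsingular (Spec (CommRingCat.of B)) ↔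
    ∀ (p : Ideal B) [p.IsPrime], IsRegularLocalRing (Localization.AtPrime p) := by
  refine ⟨fun h p hp ↦ ?_, fun h x ↦ ?_⟩
  · have := h (⟨p, hp⟩ : PrimeSpectrum B)
    exact IsRegularLocalRing.of_ringEquiv
      (Spec.stalkIso (CommRingCat.of B) ⟨p, hp⟩).commRingCatIsoToRingEquiv
  · have : (PrimeSpectrum.asIdeal x).IsPrime := PrimeSpectrum.isPrime x
    have := h (PrimeSpectrum.asIdeal x)
    exact IsRegularLocalRing.of_ringEquiv
      (Spec.stalkIso (CommRingCat.of B) x).commRingCatIsoToRingEquiv.symm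

end Nonsingular

/-! ### The theorem for affine schemes -/

section Affine

open TensorProduct

variable {k : Type u} [Field k]

lemma jetDisc_incl_eq_specOverMap {m m' : ℕ} (h : m ≤ m') :
    jetDisc.incl k h = specOverMap (JetRing.reduction k h) := rfl

/-- The jet schemes of an affine scheme of finite type: the truncation morphism is flat if the
scheme is nonsingular, and only then if the scheme is reduced. -/
theorem exists_isTruncation_specOver [PerfectField k] {m m' : ℕ} (h : m < m') (B : Type u) [CommRing B] [Algebra k B]
    [Algebra.FiniteType k B] :
    ∃ (W W' : Over (Spec (CommRingCat.of k))) (w : W ⊗ jetDisc k m ⟶ specOver k B)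
      (w' : W' ⊗ jetDisc k m' ⟶ specOver k B) (ξ : W' ⟶ W), IsUniversalFamily w ∧
        IsUniversalFamily w' ∧ IsTruncation (jetDisc.incl k h.le) w w' ξ ∧
        (_root_.IsReduced B → Flat ξ.left → IsNonsingular (specOver k B).left) ∧
        (IsNonsingular (specOver k B).left → Flat ξ.left) := by
  obtain ⟨R, _, _, υ, hυ, hR⟩ := AlgHom.exists_isUniversalFamily (k := k) B (JetRing k m)
  obtain ⟨R', _, _, υ', hυ', hR'⟩ := AlgHom.exists_isUniversalFamily (k := k) B (JetRing k m')
  obtain ⟨r, hr⟩ := (hυ R').2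
    ((Algebra.TensorProduct.map (AlgHom.id k R') (JetRing.reduction k h.le)).comp υ')
  dsimp only at hr
  let _ : Algebra R R' := r.toRingHom.toAlgebra
  have : IsScalarTower k R R' := .of_algebraMap_eq fun x ↦ (r.commutes x).symm
  have hflat : Flat (specOverMap r).left ↔ Module.Flat R R' := Flat.SpecMap_iff
  refine ⟨specOver k R, specOver k R', specOverFamily υ, specOverFamily υ', specOverMap r,
    hυ.isUniversalFamily_specOverFamily, hυ'.isUniversalFamily_specOverFamily, ?_, ?_, ?_⟩
  · rw [jetDisc_incl_eq_specOverMap]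
    refine (specOverMap_whiskerRight_specOverFamily r υ).trans ?_
    rw [hr]
    exact (specOverMap_whiskerLeft_specOverFamily (JetRing.reduction k h.le) υ').symm
  · intro _ hf
    have := hflat.mp hf
    -- The detecting element is `τ = t^(m+1)`, and the functional is the coefficient of `t^(m+1)`,
    -- available because `m + 1 ≤ m'`.
    have hτ : JetRing.reduction k h.le (Ideal.Quotient.mk _ (Polynomial.X ^ (m + 1))) = 0 := by
      rw [JetRing.reduction_mk, Ideal.Quotient.eq_zero_iff_mem]
      exact Ideal.mem_span_singleton_self _
    have : Module.Flat B Ω[B⁄k] :=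
      hυ.flat_kaehlerDifferential hυ' (JetRing.reduction k h.le)
        (JetRing.reduction_surjective k h.le) hr (JetRing.coeff k (Nat.succ_le_of_lt h))
        (by
          rw [← map_one (Ideal.Quotient.mk _), JetRing.coeff_mk, Polynomial.coeff_one]
          simp)
        (fun x y hx hy ↦ JetRing.coeff_mul_eq_zero k h hx hy) _ hτ
        (by rw [JetRing.coeff_mk]; simp)
    exact (isNonsingular_Spec_iff B).mpr fun p _ ↦
      IsRegularLocalRing.of_flat_kaehlerDifferential (k := k) p
  · intro hns
    have := Algebra.Smooth.of_isRegularLocalRing (k := k) ((isNonsingular_Spec_iff B).mp hns)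
    have : Algebra.FormallySmooth R R' := hυ.formallySmooth hυ' (JetRing.reduction k h.le)
      (JetRing.reduction_surjective k h.le) hr
    have : IsNoetherianRing R := Algebra.FiniteType.isNoetherianRing k R
    have : Algebra.FiniteType R R' := .of_restrictScalars_finiteType k R R'
    have : Algebra.FinitePresentation R R' := Algebra.FinitePresentation.of_finiteType.mp this
    have : Algebra.Smooth R R' := ⟨inferInstance, inferInstance⟩
    exact hflat.mpr (Algebra.Smooth.flat R R')

/-- An affine scheme of finite type over `k` is the spectrum of a finite type `k`-algebra. -/
lemma exists_iso_specOver_finiteType (Y : Over (Spec (CommRingCat.of k))) [IsAffine Y.left]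
    [LocallyOfFiniteType Y.hom] :
    ∃ (B : Type u) (_ : CommRing B) (_ : Algebra k B), Algebra.FiniteType k B ∧
      Nonempty (Y ≅ specOver k B) := by
  obtain ⟨B, _, _, ⟨e⟩⟩ := exists_iso_specOver Y
  refine ⟨B, _, _, ?_, ⟨e⟩⟩
  have h : LocallyOfFiniteType (Spec.map (CommRingCat.ofHom (algebraMap k B))) := by
    have : Spec.map (CommRingCat.ofHom (algebraMap k B)) = e.inv.left ≫ Y.hom := (Over.w e.inv).symm
    have hiso : IsIso e.inv.left := inferInstanceAs (IsIso ((Over.forget _).map e.inv))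
    rw [this]
    exact MorphismProperty.comp_mem _ _ _ inferInstance ‹_›
  rw [HasRingHomProperty.Spec_iff (P := @LocallyOfFiniteType)] at h
  exact RingHom.finiteType_algebraMap.mp h

/-- Universal families of jets, and their truncations, over an affine scheme of finite type. -/
theorem exists_isTruncation_of_isAffine [PerfectField k] {m m' : ℕ} (h : m < m')
    (Y : Over (Spec (CommRingCat.of k))) [IsAffine Y.left] [LocallyOfFiniteType Y.hom]
    [IsReduced Y.left] :
    ∃ (W W' : Over (Spec (CommRingCat.of k))) (w : W ⊗ jetDisc k m ⟶ Y)
      (w' : W' ⊗ jetDisc k m' ⟶ Y) (ξ : W' ⟶ W), IsUniversalFamily w ∧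
        IsUniversalFamily w' ∧ IsTruncation (jetDisc.incl k h.le) w w' ξ ∧
        (IsNonsingular Y.left ↔ Flat ξ.left) := by
  obtain ⟨B, _, _, _, ⟨e⟩⟩ := exists_iso_specOver_finiteType Y
  have h1 : IsIso e.hom.left := inferInstanceAs (IsIso ((Over.forget _).map e.hom))
  have h2 : IsIso e.inv.left := inferInstanceAs (IsIso ((Over.forget _).map e.inv))
  have hred : IsReduced (Spec (CommRingCat.of B)) := isReduced_of_isOpenImmersion e.inv.left
  obtain ⟨W, W', w, w', ξ, hw, hw', hξ, hf, hf'⟩ := exists_isTruncation_specOver (k := k) h B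
  refine ⟨W, W', w ≫ e.inv, w' ≫ e.inv, ξ, hw.comp_iso e.symm, hw'.comp_iso e.symm, ?_,
    fun hns ↦ hf' (hns.of_isOpenImmersion e.inv.left),
    fun hfl ↦ (hf ((affine_isReduced_iff _).mp hred) hfl).of_isOpenImmersion e.hom.left⟩
  rw [IsTruncation, ← Category.assoc, hξ, Category.assoc]

end Affine

/-! ### Globalization -/

section Main

variable {k : Type u} [Field k] (X : Over (Spec (CommRingCat.of k))) [LocallyOfFiniteType X.hom]

lemma locallyOfFiniteType_overRestrict {V : Scheme.{u}} (f : V ⟶ X.left) [IsOpenImmersion f] :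
    LocallyOfFiniteType (overRestrict X f).hom :=
  inferInstanceAs (LocallyOfFiniteType (f ≫ X.hom))

/-- Weil restrictions over the affine opens glue. The cover by all affine opens is directed by
inclusion, so transition maps are needed only along inclusions. -/
theorem nonempty_jetScheme (m : ℕ) : Nonempty (JetScheme X m) := by
  obtain ⟨Z, v, hv⟩ := exists_isUniversalFamily_of_openCover (jetDisc.point_hom k m) X
    X.left.directedAffineCover (fun U ↦ by
      have : IsAffine (overRestrict X (X.left.directedAffineCover.f U)).left := U.2
      have := locallyOfFiniteType_overRestrict X (X.left.directedAffineCover.f U)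
      obtain ⟨B, _, _, _, ⟨e⟩⟩ :=
        exists_iso_specOver_finiteType (overRestrict X (X.left.directedAffineCover.f U))
      obtain ⟨R, _, _, υ, hυ, -⟩ := AlgHom.exists_isUniversalFamily (k := k) B (JetRing k m)
      exact ⟨_, _, hυ.isUniversalFamily_specOverFamily.comp_iso e.symm⟩)
  exact hv.nonempty_jetScheme

variable {X} [PerfectField k] [IsReduced X.left]

theorem JetScheme.flat_truncation_iff {m m' : ℕ} (h : m < m') (J' : JetScheme X m')
    (J : JetScheme X m) :
    Flat (JetScheme.truncation h.le J' J).left ↔ IsNonsingular X.left := by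
  have : Surjective (jetDisc.point k m ≫ (jetDisc.incl k h.le).left) := by
    rw [jetDisc.point_incl]
    infer_instance
  have hloc (i : X.left.affineCover.I₀) := by
    have : IsAffine (overRestrict X (X.left.affineCover.f i)).left :=
      inferInstanceAs (IsAffine (X.left.affineCover.X i))
    have : IsReduced (overRestrict X (X.left.affineCover.f i)).left :=
      isReduced_of_isOpenImmersion (X.left.affineCover.f i)
    have := locallyOfFiniteType_overRestrict X (X.left.affineCover.f i)
    exact exists_isTruncation_of_isAffine h (overRestrict X (X.left.affineCover.f i))
  have hψ := JetScheme.isTruncation_truncation h.le J' J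
  constructor
  · intro hflat
    refine .of_openCover X.left.affineCover fun i ↦ ?_
    obtain ⟨W, W', w, w', ξ, hw, hw', hξ, hiff⟩ := hloc i
    have : IsOpenImmersion (overRestrictHom X (X.left.affineCover.f i)).left :=
      X.left.affineCover.map_prop i
    obtain ⟨a, ha⟩ := (J.isUniversalFamily W).2 (w ≫ overRestrictHom X (X.left.affineCover.f i))
    obtain ⟨a', ha'⟩ :=
      (J'.isUniversalFamily W').2 (w' ≫ overRestrictHom X (X.left.affineCover.f i))
    -- The truncation over the chart is a base change of the global one, so it inherits flatness.
    exact hiff.mpr (MorphismProperty.of_isPullback (P := @Flat)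
      (hψ.isPullback J.isUniversalFamily J'.isUniversalFamily hw hw' hξ (jetDisc.point k m)
        (jetDisc.point_hom k m) ha ha') hflat)
  · intro hns
    refine hψ.flat_of_openCover J.isUniversalFamily J'.isUniversalFamily (jetDisc.point k m)
      (jetDisc.point_hom k m) X.left.affineCover fun i ↦ ?_
    obtain ⟨W, W', w, w', ξ, hw, hw', hξ, hiff⟩ := hloc i
    exact ⟨W, W', w, w', ξ, hw, hw', hξ,
      hiff.mp (hns.of_isOpenImmersion (X.left.affineCover.f i))⟩

end Main

theorem theorem1p4 {k : Type u} [Field k] [IsAlgClosed k]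
    (X : Over (Spec (CommRingCat.of k)))
    [LocallyOfFiniteType X.hom] [QuasiCompact X.hom] [IsReduced X.left] :
    (∀ m : ℕ, Nonempty (JetScheme X m)) ∧
    ∀ J : (m : ℕ) → JetScheme X m,
      (IsNonsingular X.left ↔
        ∃ (m m' : ℕ) (h : m < m'), 0 < m ∧
          Flat (JetScheme.truncation h.le (J m') (J m)).left) :=
  ⟨nonempty_jetScheme X, fun _ ↦
    -- For non-singular `X` every truncation is flat; `(1, 2)` is just the smallest admissible pair.
    ⟨fun h ↦ ⟨1, 2, one_lt_two, one_pos, (JetScheme.flat_truncation_iff one_lt_two _ _).mpr h⟩,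
      fun ⟨_, _, h, _, hflat⟩ ↦ (JetScheme.flat_truncation_iff h _ _).mp hflat⟩⟩
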